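/- Let $R$ be a commutative ring containing $\mathbb{Q}$, let $A$ be a commutative unital $R$-algebra, and let $E$ be a finitely generated projective $A$-module with a symmetric $A$-bilinear form $\langle\cdot,\cdot\rangle:E\times E\to A$ that is strongly nondegenerate (the induced map $E\to\operatorname{Hom}_A(E,A)$ is bijective) and full (every element of $A$ is a finite sum of elements $\langle x,y\rangle$ with $x,y\in E$). Put $\mathcal C^0=A$ and $\mathcal C^1=E$. For $r\ge 2$ let $\mathcal C^r$ be the $A$-module of all $R$-multilinear maps $C:E^{r-1}\to E$ for which there is an $R$-multilinear map $\sigma_C:E^{r-2}\to\operatorname{Der}_R(A)$ (the symbol of $C$, which is unique by fullness) such that $$\sigma_C(x_1,\dots,x_{r-2})\langle u,w\rangle=\langle C(x_1,\dots,x_{r-2},u),w\rangle+\langle u,C(x_1,\dots,x_{r-2},w)\rangle$$ for all $x_j,u,w\in E$, and, if $r\ge 3$, $$\langle C(x_1,\dots,x_i,x_{i+1},\dots,x_{r-1})+C(x_1,\dots,x_{i+1},x_i,\dots,x_{r-1}),u\rangle=\sigma_C(x_1,\dots,\widehat{x_i},\widehat{x_{i+1}},\dots,x_{r-1},u)\langle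 x_i,x_{i+1}\rangle$$ for all $1\le i\le r-2$ and $x_j,u\in E$. Let $\mathcal C^\bullet(E)=\bigoplus_{r\ge0}\mathcal C^r$, and put $\mathcal C^r=0$ for $r<0$. For $x\in E$ and $C\in\mathcal C^r$ with $r\ge2$ let $i_xC\in\mathcal C^{r-1}$ be obtained by inserting $x$ in the first argument of $C$. Then the following holds. (1) There is a unique $R$-bilinear map $[\cdot,\cdot]$ on $\mathcal C^\bullet(E)$, with $[\mathcal C^r,\mathcal C^s]\subseteq\mathcal C^{r+s-2}$ and $[C_1,C_2]=-(-1)^{rs}[C_2,C_1]$ for $C_1\in\mathcal C^r$, $C_2\in\mathcal C^s$, such that $$[a,b]=0,\quad [a,x]=0=[x,a],\quad [x,y]=\langle x,y\rangle,\quad [D,a]=\sigma_D a=-[a,D],\quad [C,x]=i_xC=(-1)^{r+1}[x,C]$$ for $a,b\in A$, $x,y\in E$, $D\in\mathcal C^2$, $C\in\mathcal C^r$ with $r\ge2$, and $$[[C_1,C_2],x]=(-1)^s[[C_1,x],C_2]+[C_1,[C_2,x]]$$ for all $r,s\ge0$, $C_1\in\mathcal C^r$, $C_2\in\mathcal C^s$,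 $x\in E$. (2) There is a unique $R$-bilinear product $\wedge$ on $\mathcal C^\bullet(E)$, with $\mathcal C^r\wedge\mathcal C^s\subseteq\mathcal C^{r+s}$, such that $a\wedge b=ab$ and $a\wedge x=ax=x\wedge a$ for $a,b\in A$, $x\in E$, and $$[C_1\wedge C_2,x]=(-1)^s[C_1,x]\wedge C_2+C_1\wedge[C_2,x]$$ for all $r,s\ge0$, $C_1\in\mathcal C^r$, $C_2\in\mathcal C^s$, $x\in E$. (3) $(\mathcal C^\bullet(E),[\cdot,\cdot],\wedge)$ is a graded Poisson algebra of degree $-2$: $\wedge$ is associative and unital, and for all $C_1\in\mathcal C^r$, $C_2\in\mathcal C^s$, $C_3\in\mathcal C^t$ one has, besides the degree statements and the skew-symmetry of the bracket above, $$C_1\wedge C_2=(-1)^{rs}C_2\wedge C_1,$$ $$[C_1,[C_2,C_3]]=[[C_1,C_2],C_3]+(-1)^{rs}[C_2,[C_1,C_3]],$$ $$[C_1,C_2\wedge C_3]=[C_1,C_2]\wedge C_3+(-1)^{rs}C_2\wedge[C_1,C_3].$$ -/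

import Mathlib

universe u v

namespace Courant

open DirectSum

section Components

variable (R : Type*) {A E : Type*} [CommRing R] [CommRing A] [Algebra R A]
  [AddCommGroup E] [Module R E] [Module A E] [IsScalarTower R A E]

/-- Delete the two adjacent entries with (zero-based) positions `i` and `i + 1` from a tuple
`(y₀, …, yₙ₊₁)`. -/
def elideTwo {n : ℕ} (i : ℕ) (y : Fin (n + 2) → E) : Fin n → E :=
  fun j => if j.val < i then y (Fin.castAdd 2 j) else y (Fin.addNat j 2)

variable {R} in
/-- `σ` is a symbol of the `R`-multilinear map `C : E^(n+1) → E` (with respect to the `A`-valued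
inner product `B`).  In the usual numbering `C` is a candidate for an element of degree
`r = n + 2`: it has `r - 1` arguments and its symbol has `r - 2` arguments. -/
structure IsSymbol (B : LinearMap.BilinForm A E) {n : ℕ}
    (C : MultilinearMap R (fun _ : Fin (n + 1) => E) E)
    (σ : MultilinearMap R (fun _ : Fin n => E) (Derivation R A A)) : Prop where
  /-- `σ(x₁,…,x_{r-2})⟨u,w⟩ = ⟨C(x₁,…,x_{r-2},u),w⟩ + ⟨u,C(x₁,…,x_{r-2},w)⟩`. -/
  der : ∀ (x : Fin n → E) (u w : E),
    σ x (B u w) = B (C (Fin.snoc x u)) w + B u (C (Fin.snoc x w))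
  /-- `⟨C(…,xᵢ,xᵢ₊₁,…) + C(…,xᵢ₊₁,xᵢ,…),u⟩ = σ(x₁,…,x̂ᵢ,x̂ᵢ₊₁,…,x_{r-1},u)⟨xᵢ,xᵢ₊₁⟩`; there is no
  such condition for `n = 0`. -/
  symm : ∀ (x : Fin (n + 1) → E) (u : E) (i : Fin n),
    B (C x + C (x ∘ Equiv.swap i.castSucc i.succ)) u =
      σ (elideTwo i.val (Fin.snoc x u : Fin (n + 2) → E)) (B (x i.castSucc) (x i.succ))

instance (n : ℕ) : IsScalarTower R A (MultilinearMap R (fun _ : Fin n => E) E) :=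
  ⟨fun r a f => by ext x; exact smul_assoc r a (f x)⟩

/-- The module `𝒞^(n+2)(E)`: multilinear maps `E^(n+1) → E` that possess a symbol. -/
def multibrackets (B : LinearMap.BilinForm A E) (n : ℕ) :
    Submodule A (MultilinearMap R (fun _ : Fin (n + 1) => E) E) where
  carrier := {C | ∃ σ, IsSymbol B C σ}
  zero_mem' := ⟨0, by constructor <;> simp⟩
  add_mem' := by
    rintro C C' ⟨σ, h⟩ ⟨σ', h'⟩
    refine ⟨σ + σ', ⟨fun x u w => ?_, fun x u i => ?_⟩⟩
    · have h1 := h.der x u w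
      have h2 := h'.der x u w
      simp only [_root_.add_apply, Derivation.add_apply, map_add,
        LinearMap.add_apply, h1, h2]
      ring
    · have h1 := h.symm x u i
      have h2 := h'.symm x u i
      simp only [_root_.add_apply, Derivation.add_apply, map_add,
        LinearMap.add_apply] at h1 h2 ⊢
      rw [← h1, ← h2]
      ring
  smul_mem' := by
    rintro a C ⟨σ, h⟩
    refine ⟨a • σ, ⟨fun x u w => ?_, fun x u i => ?_⟩⟩
    · have h1 := h.der x u w
      simp only [_root_.smul_apply, Derivation.smul_apply, map_smul,
        LinearMap.smul_apply, smul_eq_mul, h1]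
      ring
    · have h1 := h.symm x u i
      simp only [_root_.smul_apply, Derivation.smul_apply, map_smul, map_add,
        LinearMap.add_apply, LinearMap.smul_apply, smul_eq_mul] at h1 ⊢
      rw [← h1]
      ring

variable {R}

/-- A symbol of an element of `𝒞^(n+2)(E)`.  It is the only one when `B` is full, see
`IsSymbol.unique`. -/
noncomputable def symbol {B : LinearMap.BilinForm A E} {n : ℕ} (C : multibrackets R B n) :
    MultilinearMap R (fun _ : Fin n => E) (Derivation R A A) :=
  C.2.choose

theorem symbol_spec {B : LinearMap.BilinForm A E} {n : ℕ} (C : multibrackets R B n) :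
    IsSymbol B C.1 (symbol C) :=
  C.2.choose_spec

set_option linter.unusedSectionVars false in
theorem IsSymbol.unique {B : LinearMap.BilinForm A E}
    (hfull : Function.Surjective (TensorProduct.lift B)) {n : ℕ}
    {C : MultilinearMap R (fun _ : Fin (n + 1) => E) E}
    {σ τ : MultilinearMap R (fun _ : Fin n => E) (Derivation R A A)}
    (hσ : IsSymbol B C σ) (hτ : IsSymbol B C τ) : σ = τ := by
  ext x a
  obtain ⟨t, rfl⟩ := hfull a
  induction t using TensorProduct.induction_on with
  | zero => simp
  | tmul u w => simp only [TensorProduct.lift.tmul, hσ.der, hτ.der]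
  | add s t hs ht => simp only [map_add, hs, ht]

set_option linter.unusedSectionVars false in
theorem elideTwo_succ_cons {n : ℕ} (i : ℕ) (x : E) (y : Fin (n + 2) → E) :
    elideTwo (i + 1) (Fin.cons x y : Fin (n + 3) → E) =
      (Fin.cons x (elideTwo i y) : Fin (n + 1) → E) := by
  funext j
  refine Fin.cases ?_ (fun k => ?_) j
  · simp only [elideTwo, Fin.val_zero, Nat.zero_lt_succ, if_true, Fin.cons_zero]
    rfl
  · simp only [elideTwo, Fin.val_succ, Fin.cons_succ, Nat.add_lt_add_iff_right]
    split_ifs <;> rfl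

/-- Inserting `x` in the first argument of an element of `𝒞^r(E)`, `r ≥ 3`, gives an element of
`𝒞^(r-1)(E)`. -/
def insertFirst {B : LinearMap.BilinForm A E} {n : ℕ} (x : E)
    (C : multibrackets R B (n + 1)) : multibrackets R B n :=
  ⟨C.1.curryLeft x, by
    obtain ⟨C, σ, h⟩ := C
    refine ⟨σ.curryLeft x, ⟨fun y u w => ?_, fun y u i => ?_⟩⟩
    · have h1 := h.der (Fin.cons x y) u w
      simpa only [MultilinearMap.curryLeft_apply, Fin.cons_snoc_eq_snoc_cons] using h1
    · have h1 := h.symm (Fin.cons x y) u i.succ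
      have h2 : (Fin.cons x y : Fin (n + 2) → E) ∘ Equiv.swap i.succ.castSucc i.succ.succ =
          Fin.cons x (y ∘ Equiv.swap i.castSucc i.succ) := by
        funext j
        refine Fin.cases ?_ (fun k => ?_) j
        · rw [Function.comp_apply, Equiv.swap_apply_of_ne_of_ne]
          · simp
          · exact (Fin.succ_ne_zero i.castSucc).symm
          · exact (Fin.succ_ne_zero _).symm
        · have : Equiv.swap i.succ.castSucc i.succ.succ k.succ =
              (Equiv.swap i.castSucc i.succ k).succ := by
            simp only [Equiv.swap_apply_def, Fin.castSucc_succ, Fin.succ_inj]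
            split_ifs <;> rfl
          rw [Function.comp_apply, this, Fin.cons_succ, Fin.cons_succ, Function.comp_apply]
      rw [h2, ← Fin.cons_snoc_eq_snoc_cons, Fin.val_succ, elideTwo_succ_cons] at h1
      exact h1⟩

end Components

section Total

variable (R : Type v) {A E : Type u} [CommRing R] [CommRing A] [Algebra R A]
  [AddCommGroup E] [Module R E] [Module A E] [IsScalarTower R A E]

/-- The components `𝒞^0(E) = A`, `𝒞^1(E) = E` and `𝒞^r(E)` for `r ≥ 2`. -/
def Component (B : LinearMap.BilinForm A E) : ℕ → Type u
  | 0 => A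
  | 1 => E
  | n + 2 => multibrackets R B n

instance (B : LinearMap.BilinForm A E) : ∀ r, AddCommGroup (Component R B r)
  | 0 => inferInstanceAs (AddCommGroup A)
  | 1 => inferInstanceAs (AddCommGroup E)
  | n + 2 => inferInstanceAs (AddCommGroup (multibrackets R B n))

instance (B : LinearMap.BilinForm A E) : ∀ r, Module A (Component R B r)
  | 0 => inferInstanceAs (Module A A)
  | 1 => inferInstanceAs (Module A E)
  | n + 2 => inferInstanceAs (Module A (multibrackets R B n))

instance (B : LinearMap.BilinForm A E) : ∀ r, Module R (Component R B r)
  | 0 => inferInstanceAs (Module R A)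
  | 1 => inferInstanceAs (Module R E)
  | n + 2 => inferInstanceAs (Module R (multibrackets R B n))

/-- The graded module `𝒞^•(E) = ⨁_{r ≥ 0} 𝒞^r(E)`. -/
abbrev CourantModule (B : LinearMap.BilinForm A E) : Type u := ⨁ r, Component R B r

/-- The embedding of `𝒞^r(E)` into `𝒞^•(E)`. -/
noncomputable abbrev incl (B : LinearMap.BilinForm A E) (r : ℕ) :
    Component R B r →ₗ[R] CourantModule R B :=
  DirectSum.lof R ℕ (Component R B) r

/-- Elements of `A`, in degree `0`. -/
noncomputable def ofScalar (B : LinearMap.BilinForm A E) (a : A) : CourantModule R B :=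
  incl R B 0 a

/-- Elements of `E`, in degree `1`. -/
noncomputable def ofVector (B : LinearMap.BilinForm A E) (x : E) : CourantModule R B :=
  incl R B 1 x

variable {R} in
/-- Elements of `𝒞^(n+2)(E)`, in degree `n + 2`. -/
noncomputable def ofMap {B : LinearMap.BilinForm A E} {n : ℕ} (C : multibrackets R B n) :
    CourantModule R B :=
  incl R B (n + 2) C

variable {R} in
/-- Insertion of `x : E` in the first argument of `C ∈ 𝒞^r(E)`, `r = n + 2 ≥ 2`, as an element of
degree `r - 1`; for `r = 2` this is the vector `C(x)`. -/
noncomputable def insertion {B : LinearMap.BilinForm A E} (x : E) :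
    ∀ {n : ℕ}, multibrackets R B n → CourantModule R B
  | 0, D => ofVector R B (D.1 fun _ => x)
  | _ + 1, C => ofMap (insertFirst x C)

/-- The homogeneous elements of degree `n : ℤ` of `𝒞^•(E)` (only `0` when `n < 0`). -/
noncomputable def homogeneous (B : LinearMap.BilinForm A E) : ℤ → Submodule R (CourantModule R B)
  | Int.ofNat r => LinearMap.range (incl R B r)
  | Int.negSucc _ => ⊥

/-- The recursive characterization of the bracket of degree `-2` on `𝒞^•(E)`. -/
structure IsBracket (B : LinearMap.BilinForm A E)
    (br : CourantModule R B →ₗ[R] CourantModule R B →ₗ[R] CourantModule R B) : Prop where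
  degree : ∀ (m n : ℤ), ∀ c ∈ homogeneous R B m, ∀ d ∈ homogeneous R B n,
    br c d ∈ homogeneous R B (m + n - 2)
  skew : ∀ (r s : ℕ) (c : Component R B r) (d : Component R B s),
    br (incl R B r c) (incl R B s d) = -((-1 : ℤ) ^ (r * s) • br (incl R B s d) (incl R B r c))
  scalar_scalar : ∀ a b : A, br (ofScalar R B a) (ofScalar R B b) = 0
  scalar_vector : ∀ (a : A) (x : E), br (ofScalar R B a) (ofVector R B x) = 0
  vector_scalar : ∀ (a : A) (x : E), br (ofVector R B x) (ofScalar R B a) = 0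
  vector_vector : ∀ x y : E, br (ofVector R B x) (ofVector R B y) = ofScalar R B (B x y)
  map_scalar : ∀ (D : multibrackets R B 0) (a : A),
    br (ofMap D) (ofScalar R B a) = ofScalar R B (symbol D Fin.elim0 a)
  scalar_map : ∀ (D : multibrackets R B 0) (a : A),
    br (ofScalar R B a) (ofMap D) = -ofScalar R B (symbol D Fin.elim0 a)
  map_vector : ∀ (n : ℕ) (C : multibrackets R B n) (x : E),
    br (ofMap C) (ofVector R B x) = insertion x C
  vector_map : ∀ (n : ℕ) (C : multibrackets R B n) (x : E),
    insertion x C = (-1 : ℤ) ^ (n + 2 + 1) • br (ofVector R B x) (ofMap C)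
  recursion : ∀ (r s : ℕ) (c : Component R B r) (d : Component R B s) (x : E),
    br (br (incl R B r c) (incl R B s d)) (ofVector R B x) =
      (-1 : ℤ) ^ s • br (br (incl R B r c) (ofVector R B x)) (incl R B s d) +
        br (incl R B r c) (br (incl R B s d) (ofVector R B x))

/-- The recursive characterization of the product `∧` of degree `0` on `𝒞^•(E)`, given the
bracket. -/
structure IsWedge (B : LinearMap.BilinForm A E)
    (br w : CourantModule R B →ₗ[R] CourantModule R B →ₗ[R] CourantModule R B) : Prop where
  degree : ∀ (m n : ℤ), ∀ c ∈ homogeneous R B m, ∀ d ∈ homogeneous R B n,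
    w c d ∈ homogeneous R B (m + n)
  scalar_scalar : ∀ a b : A, w (ofScalar R B a) (ofScalar R B b) = ofScalar R B (a * b)
  scalar_vector : ∀ (a : A) (x : E), w (ofScalar R B a) (ofVector R B x) = ofVector R B (a • x)
  vector_scalar : ∀ (a : A) (x : E), w (ofVector R B x) (ofScalar R B a) = ofVector R B (a • x)
  recursion : ∀ (r s : ℕ) (c : Component R B r) (d : Component R B s) (x : E),
    br (w (incl R B r c) (incl R B s d)) (ofVector R B x) =
      (-1 : ℤ) ^ s • w (br (incl R B r c) (ofVector R B x)) (incl R B s d) +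
        w (incl R B r c) (br (incl R B s d) (ofVector R B x))

end Total

/-- `(L, br, w)`, with the `ℤ`-grading `𝒜` on the `R`-module `L`, is a graded Poisson algebra of
degree `k` over `R`: `w` is an associative, unital, graded commutative product of degree `0`, `br`
is a graded Lie bracket of degree `k` (that is, a graded Lie bracket of degree `0` for the grading
shifted by `k`), and `br c` is a graded derivation of `w`. -/
structure IsGradedPoissonAlgebra (R : Type*) {L : Type*} [CommRing R] [AddCommGroup L] [Module R L]
    (k : ℤ) (𝒜 : ℤ → Submodule R L) (br w : L →ₗ[R] L →ₗ[R] L) : Prop where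
  isInternal : DirectSum.IsInternal 𝒜
  mul_degree : ∀ m n, ∀ c ∈ 𝒜 m, ∀ d ∈ 𝒜 n, w c d ∈ 𝒜 (m + n)
  mul_assoc : ∀ c d e, w (w c d) e = w c (w d e)
  mul_comm : ∀ m n, ∀ c ∈ 𝒜 m, ∀ d ∈ 𝒜 n, w c d = (m * n).negOnePow • w d c
  exists_one : ∃ e ∈ 𝒜 0, ∀ c, w e c = c ∧ w c e = c
  bracket_degree : ∀ m n, ∀ c ∈ 𝒜 m, ∀ d ∈ 𝒜 n, br c d ∈ 𝒜 (m + n + k)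
  bracket_skew : ∀ m n, ∀ c ∈ 𝒜 m, ∀ d ∈ 𝒜 n,
    br c d = -(((m + k) * (n + k)).negOnePow • br d c)
  jacobi : ∀ m n p, ∀ c ∈ 𝒜 m, ∀ d ∈ 𝒜 n, ∀ e ∈ 𝒜 p,
    br c (br d e) = br (br c d) e + ((m + k) * (n + k)).negOnePow • br d (br c e)
  leibniz : ∀ m n p, ∀ c ∈ 𝒜 m, ∀ d ∈ 𝒜 n, ∀ e ∈ 𝒜 p,
    br c (w d e) = w (br c d) e + ((m + k) * n).negOnePow • w d (br c e)

end Courant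

/-! An element `C` of degree `r` is determined by the function on words `x₁⋯xᵣ ↦ [⋯[C, x₁], ⋯, xᵣ] ∈
A`, which for `r ≥ 2` is `⟨C(x₁,…,x_{r-1}), xᵣ⟩`; nondegeneracy makes this faithful. The symbol can
be read off as well. The anticommutator of the insertions of `x` and `y` depends only on `⟨x,y⟩`,
and fullness gives a finite set `S` of pairs with `1 = ∑ ⟨p,q⟩`; summing the anticommutators of `a
p` and `q` over `S` gives an operator `Δ_a`, the insertion of the scalar `a`. So `𝒞^•(E)` embeds in
the space `cochains` of word functions on which, with `ι_x` the insertion of `x` and `κ` the value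
at the empty word, `ι_x ι_y + ι_y ι_x = Δ_⟨x,y⟩`, each `Δ_a` commutes with all `ι_x`, `κ ι_x` is
`A`-linear in `x`, and `κ Δ_a` is a derivation in `a`.

Both recursions say that the `ι_x` are graded derivations. Unrolled along a word, this expresses a
product through its constant term `β` (`convolutionValue`). Conversely, the relations between the
operators pass from the factors to the product, so any `β` satisfying the two conditions of
`IsCochainPairing` defines an operation on cochains. For the wedge product `β(f,g) = κf κg`; for the
bracket `β(f,g) = κΔ_{κg}f - κΔ_{κf}g + ⟨f♯,g♯⟩`, where `f♯ ∈ E` represents the degree one part of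
`f`.

Inserting a letter into commutativity, associativity, skew-symmetry, Leibniz rule or Jacobi identity
gives a signed sum of instances of the same identity. Induction on the word therefore leaves only
constant terms to compare; the one substantial computation is `cochainBracket_jacobi_nil`.

To return to `𝒞^•(E)`, `isSymbol_iterContract` rebuilds a multilinear map with symbol from a
cochain, so homogeneous cochains of degree `r ≥ 0` are exactly the images of `𝒞^r`. Operations
respecting the grading then lift. Uniqueness (`eq_of_recursion`) holds because an element of nonzero
degree is determined by its insertions. -/

namespace Courant

open DirectSum

/-! ### Word functions, insertions of vectors and scalars, and the grading. -/

section Words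

variable {R A E : Type*} [CommRing R] [CommRing A] [Algebra R A]
  [AddCommGroup E] [Module R E] [Module A E] [IsScalarTower R A E]

/-- The anticommutator of the insertions of `a • p.1` and `p.2`, summed over `p ∈ S`. -/
def anticommSum (S : Finset (E × E)) (a : A) (f : List E → A) (w : List E) : A :=
  ∑ p ∈ S, (f (a • p.1 :: p.2 :: w) + f (p.2 :: a • p.1 :: w))

variable (R) in
/-- The conditions on the first letters of a word function. -/
structure IsHeadCochain (B : LinearMap.BilinForm A E) (S : Finset (E × E)) (f : List E → A) :
    Prop where
  add : ∀ x y w, f ((x + y) :: w) = f (x :: w) + f (y :: w)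
  smul : ∀ (r : R) x w, f ((r • x) :: w) = r • f (x :: w)
  last : ∀ (a : A) x, f [a • x] = a * f [x]
  anti : ∀ x y w, f (x :: y :: w) + f (y :: x :: w) = anticommSum S (B x y) f w
  comm : ∀ a x w, anticommSum S a f (x :: w) = anticommSum S a (fun v => f (x :: v)) w
  leibniz : ∀ a b, anticommSum S (a * b) f [] =
    a * anticommSum S b f [] + b * anticommSum S a f []

theorem anticommSum_add (S : Finset (E × E)) (a : A) (f g : List E → A) (w : List E) :
    anticommSum S a (f + g) w = anticommSum S a f w + anticommSum S a g w := by
  simp only [anticommSum, Pi.add_apply, ← Finset.sum_add_distrib]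
  exact Finset.sum_congr rfl fun _ _ => by ring

set_option linter.unusedSectionVars false in
theorem anticommSum_smul (S : Finset (E × E)) (a : A) (r : R) (f : List E → A) (w : List E) :
    anticommSum S a (r • f) w = r • anticommSum S a f w := by
  simp only [anticommSum, Pi.smul_apply, Finset.smul_sum, smul_add]

variable (R) in
/-- The word functions satisfying `IsHeadCochain`. -/
def headCochains (B : LinearMap.BilinForm A E) (S : Finset (E × E)) :
    Submodule R (List E → A) where
  carrier := {f | IsHeadCochain R B S f}
  zero_mem' := by constructor <;> simp [anticommSum]
  add_mem' := by
    rintro f g hf hg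
    refine ⟨fun x y w => ?_, fun r x w => ?_, fun a x => ?_, fun x y w => ?_, fun a x w => ?_,
      fun a b => ?_⟩
    · simp only [Pi.add_apply, hf.add, hg.add]; ring
    · simp only [Pi.add_apply, hf.smul, hg.smul, smul_add]
    · simp only [Pi.add_apply, hf.last, hg.last]; ring
    · rw [anticommSum_add, ← hf.anti, ← hg.anti]; simp only [Pi.add_apply]; ring
    · rw [anticommSum_add, hf.comm, hg.comm, ← anticommSum_add]; rfl
    · simp only [anticommSum_add, hf.leibniz, hg.leibniz]; ring
  smul_mem' := by
    rintro c f hf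
    refine ⟨fun x y w => ?_, fun r x w => ?_, fun a x => ?_, fun x y w => ?_, fun a x w => ?_,
      fun a b => ?_⟩
    · simp only [Pi.smul_apply, hf.add, smul_add]
    · simp only [Pi.smul_apply, hf.smul, smul_comm c r]
    · simp only [Pi.smul_apply, hf.last, mul_smul_comm]
    · rw [anticommSum_smul, ← hf.anti]; simp only [Pi.smul_apply, smul_add]
    · rw [anticommSum_smul, hf.comm, ← anticommSum_smul]; rfl
    · simp only [anticommSum_smul, hf.leibniz, smul_add, mul_smul_comm]

variable (R) in
/-- The module of word functions modelling `𝒞^•(E)`: the value at `x₁ ⋯ xᵣ` is the iterated bracket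
`[⋯[C, x₁], ⋯, xᵣ]`. -/
def cochains (B : LinearMap.BilinForm A E) (S : Finset (E × E)) : Submodule R (List E → A) where
  carrier := {f | ∀ u : List E, (fun w => f (u ++ w)) ∈ headCochains R B S}
  zero_mem' := fun _ => (headCochains R B S).zero_mem
  add_mem' := fun hf hg u => (headCochains R B S).add_mem (hf u) (hg u)
  smul_mem' := fun r _ hf u => (headCochains R B S).smul_mem r (hf u)

variable {B : LinearMap.BilinForm A E} {S : Finset (E × E)}

theorem mem_cochains_cons {f : List E → A} (hf : f ∈ cochains R B S) (x : E) :
    (fun w => f (x :: w)) ∈ cochains R B S :=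
  fun u => hf (x :: u)

/-- Coinduction principle for membership in `cochains`. -/
theorem subset_cochains (T : Set (List E → A)) (hT : T ⊆ headCochains R B S)
    (hcons : ∀ f ∈ T, ∀ x, (fun w => f (x :: w)) ∈ Submodule.span R T) :
    T ⊆ cochains R B S := by
  -- The statement is made for the whole span so that induction on the prefix works: insertion maps
  -- the span of `T` to itself, and the head conditions are linear in `f`.
  have key : ∀ (u : List E), ∀ f ∈ Submodule.span R T,
      (fun w => f (u ++ w)) ∈ headCochains R B S := by
    intro u
    induction u with
    | nil => exact fun f hf => Submodule.span_le.2 hT hf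
    | cons x u ih =>
      intro f hf
      refine ih (fun w => f (x :: w)) ?_
      induction hf using Submodule.span_induction with
      | mem f hf => exact hcons f hf x
      | zero => exact Submodule.zero_mem _
      | add f g _ _ hf hg => exact Submodule.add_mem _ hf hg
      | smul r f _ hf => exact Submodule.smul_mem _ r hf
  exact fun f hf u => key u f (Submodule.subset_span hf)

theorem cochains_head (f : cochains R B S) : IsHeadCochain R B S f.1 := f.2 []

variable (R B S) in
/-- Insertion of a vector in the first place. -/
def contract : E →ₗ[R] cochains R B S →ₗ[R] cochains R B S :=
  LinearMap.mk₂ R (fun x f => ⟨fun w => f.1 (x :: w), mem_cochains_cons f.2 x⟩)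
    (fun x y f => Subtype.ext <| funext fun w => (cochains_head f).add x y w)
    (fun r x f => Subtype.ext <| funext fun w => (cochains_head f).smul r x w)
    (fun _ _ _ => rfl) (fun _ _ _ => rfl)

@[simp] theorem contract_apply (x : E) (f : cochains R B S) (w : List E) :
    (contract R B S x f).1 w = f.1 (x :: w) := rfl

theorem cochains_ext {f g : cochains R B S} (h : ∀ w, f.1 w = g.1 w) : f = g :=
  Subtype.ext (funext h)

variable (R B S) in
/-- The value at the empty word. -/
def constTerm : cochains R B S →ₗ[R] A :=
  (LinearMap.proj ([] : List E)).comp (cochains R B S).subtype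

theorem constTerm_apply (f : cochains R B S) : constTerm R B S f = f.1 [] := rfl

variable (R B S) in
/-- Insertion of a scalar, by means of the symbol. -/
def scalarContract : A →ₗ[R] cochains R B S →ₗ[R] cochains R B S :=
  LinearMap.mk₂ R
    (fun a f => ∑ p ∈ S, (contract R B S p.2 (contract R B S (a • p.1) f) +
      contract R B S (a • p.1) (contract R B S p.2 f)))
    (fun a b f => by
      simp only [add_smul, map_add, LinearMap.add_apply, ← Finset.sum_add_distrib]
      exact Finset.sum_congr rfl fun _ _ => by abel)
    (fun r a f => by
      simp only [smul_assoc, map_smul, LinearMap.smul_apply, Finset.smul_sum, smul_add])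
    (fun a f g => by
      simp only [map_add, ← Finset.sum_add_distrib]
      exact Finset.sum_congr rfl fun _ _ => by abel)
    (fun r a f => by simp only [map_smul, Finset.smul_sum, smul_add])

theorem scalarContract_eq (a : A) (f : cochains R B S) :
    scalarContract R B S a f = ∑ p ∈ S, (contract R B S p.2 (contract R B S (a • p.1) f) +
      contract R B S (a • p.1) (contract R B S p.2 f)) := rfl

theorem scalarContract_apply (a : A) (f : cochains R B S) (w : List E) :
    (scalarContract R B S a f).1 w = anticommSum S a f.1 w := by
  simp only [scalarContract_eq, AddSubmonoidClass.coe_finsetSum, Finset.sum_apply]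
  rfl

theorem contract_anticomm (x y : E) (f : cochains R B S) :
    contract R B S y (contract R B S x f) + contract R B S x (contract R B S y f) =
      scalarContract R B S (B x y) f :=
  cochains_ext fun w => ((cochains_head f).anti x y w).trans (scalarContract_apply _ _ _).symm

theorem scalarContract_contract (a : A) (x : E) (f : cochains R B S) :
    scalarContract R B S a (contract R B S x f) = contract R B S x (scalarContract R B S a f) :=
  cochains_ext fun w => by
    rw [scalarContract_apply, contract_apply, scalarContract_apply]
    exact ((cochains_head f).comm a x w).symm

/-- `Δ_b` is a sum of products of two vector insertions, and `Δ_a` commutes with each of these. -/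
theorem scalarContract_comm (a b : A) (f : cochains R B S) :
    scalarContract R B S a (scalarContract R B S b f) =
      scalarContract R B S b (scalarContract R B S a f) := by
  rw [scalarContract_eq b f, scalarContract_eq b]
  simp only [map_sum, map_add, scalarContract_contract]

theorem constTerm_contract_smul (a : A) (x : E) (f : cochains R B S) :
    constTerm R B S (contract R B S (a • x) f) = a * constTerm R B S (contract R B S x f) :=
  (cochains_head f).last a x

theorem constTerm_scalarContract_mul (a b : A) (f : cochains R B S) :
    constTerm R B S (scalarContract R B S (a * b) f) =
      a * constTerm R B S (scalarContract R B S b f) +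
        b * constTerm R B S (scalarContract R B S a f) := by
  simp only [constTerm_apply, scalarContract_apply]
  exact (cochains_head f).leibniz a b

variable (R B S) in
/-- The grading involution. -/
def involute : cochains R B S →ₗ[R] cochains R B S :=
  LinearMap.codRestrict _
    { toFun := fun f w => (-1 : R) ^ w.length • f.1 w
      map_add' := fun f g => funext fun w => smul_add _ _ _
      map_smul' := fun r f => funext fun w => smul_comm _ _ _ }
    (fun f => by
      refine subset_cochains (R := R) (Set.range fun (g : cochains R B S) (w : List E) =>
        (-1 : R) ^ w.length • g.1 w) ?_ ?_ ⟨f, rfl⟩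
      · rintro _ ⟨g, rfl⟩
        have hg := cochains_head g
        have hD : ∀ a w, anticommSum S a (fun v => (-1 : R) ^ v.length • g.1 v) w =
            (-1 : R) ^ w.length • anticommSum S a g.1 w := by
          intro a w
          simp [anticommSum, Finset.smul_sum, pow_succ, smul_add]
        refine ⟨fun x y w => ?_, fun r x w => ?_, fun a x => ?_, fun x y w => ?_,
          fun a x w => ?_, fun a b => ?_⟩
        · simp [hg.add]
        · simp [hg.smul, smul_comm r]
        · simp [hg.last]
        · rw [hD, ← hg.anti]
          simp [pow_succ]
        · rw [hD, hg.comm]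
          simp [anticommSum, Finset.smul_sum, pow_succ, smul_add]
        · simp only [hD, hg.leibniz, List.length_nil, pow_zero, one_smul]
      · rintro _ ⟨g, rfl⟩ x
        have : (fun w : List E => (-1 : R) ^ (x :: w).length • g.1 (x :: w)) =
            (-1 : R) • fun w : List E => (-1 : R) ^ w.length • (contract R B S x g).1 w := by
          funext w
          simp [pow_succ]
        rw [this]
        exact Submodule.smul_mem _ _ (Submodule.subset_span ⟨_, rfl⟩))

theorem involute_apply (f : cochains R B S) (w : List E) :
    (involute R B S f).1 w = (-1 : R) ^ w.length • f.1 w := rfl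

theorem contract_involute (x : E) (f : cochains R B S) :
    contract R B S x (involute R B S f) = -involute R B S (contract R B S x f) :=
  cochains_ext fun w => by
    rw [contract_apply, involute_apply]
    change _ = -((-1 : R) ^ w.length • f.1 (x :: w))
    simp [pow_succ]

theorem involute_involute (f : cochains R B S) : involute R B S (involute R B S f) = f :=
  cochains_ext fun w => by
    rw [involute_apply, involute_apply, smul_smul, ← mul_pow]
    simp

theorem constTerm_involute (f : cochains R B S) :
    constTerm R B S (involute R B S f) = constTerm R B S f := by
  simp [constTerm_apply, involute_apply]

theorem scalarContract_involute (a : A) (f : cochains R B S) :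
    scalarContract R B S a (involute R B S f) = involute R B S (scalarContract R B S a f) := by
  simp only [scalarContract_eq, contract_involute, map_neg, neg_neg, map_sum, map_add]

variable (R) in
/-- The sign `(-1)^n`. -/
def gradedSign (n : ℤ) : R := ((n.negOnePow : ℤ) : R)

theorem gradedSign_add (m n : ℤ) : gradedSign R (m + n) = gradedSign R m * gradedSign R n := by
  simp [gradedSign, Int.negOnePow_add]

theorem gradedSign_sub (m n : ℤ) : gradedSign R (m - n) = gradedSign R m * gradedSign R n := by
  simp [gradedSign, Int.negOnePow_sub]

theorem gradedSign_mul_self (n : ℤ) : gradedSign R n * gradedSign R n = 1 := by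
  rw [← gradedSign_add, gradedSign, Int.negOnePow_even _ ⟨n, rfl⟩]
  simp

theorem gradedSign_even {n : ℤ} (h : Even n) : gradedSign R n = 1 := by
  simp [gradedSign, Int.negOnePow_even n h]

theorem gradedSign_odd {n : ℤ} (h : Odd n) : gradedSign R n = -1 := by
  simp [gradedSign, Int.negOnePow_odd n h]

theorem gradedSign_natCast (n : ℕ) : gradedSign R n = (-1) ^ n := by
  simp [gradedSign, Int.negOnePow_def]

variable (R B S) in
/-- Word functions supported on words of length `n`. -/
def IsHomogeneousCochain (n : ℤ) (f : cochains R B S) : Prop :=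
  ∀ w, (w.length : ℤ) ≠ n → f.1 w = 0

namespace IsHomogeneousCochain

variable {n : ℤ} {f : cochains R B S}

theorem contract (h : IsHomogeneousCochain R B S n f) (x : E) :
    IsHomogeneousCochain R B S (n - 1) (contract R B S x f) :=
  fun w hw => h (x :: w) fun h' => hw <| by simp at h'; omega

theorem scalarContract (h : IsHomogeneousCochain R B S n f) (a : A) :
    IsHomogeneousCochain R B S (n - 2) (scalarContract R B S a f) := by
  intro w hw
  rw [scalarContract_apply]
  refine Finset.sum_eq_zero fun p _ => ?_
  rw [h _ fun h' => hw <| by simp at h'; omega, h _ fun h' => hw <| by simp at h'; omega, add_zero]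

theorem involute_eq (h : IsHomogeneousCochain R B S n f) :
    involute R B S f = gradedSign R n • f := by
  refine cochains_ext fun w => ?_
  rw [involute_apply]
  change _ = gradedSign R n • f.1 w
  by_cases hw : (w.length : ℤ) = n
  · rw [← hw, gradedSign_natCast]
  · rw [h w hw, smul_zero, smul_zero]

theorem constTerm_eq_zero (h : IsHomogeneousCochain R B S n f) (hn : n ≠ 0) :
    constTerm R B S f = 0 :=
  h [] fun h' => hn <| by simpa using h'.symm

theorem eq_zero (h : IsHomogeneousCochain R B S n f) (hn : n < 0) : f = 0 :=
  cochains_ext fun w => h w (by omega)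

end IsHomogeneousCochain

variable (R B S) in
/-- The linear functional given by the degree one part. -/
def linearPart : cochains R B S →ₗ[R] Module.Dual A E where
  toFun f :=
    { toFun := fun x => f.1 [x]
      map_add' := fun x y => (cochains_head f).add x y []
      map_smul' := fun a x => (cochains_head f).last a x }
  map_add' _ _ := rfl
  map_smul' _ _ := LinearMap.ext fun _ => rfl

variable (R S) in
/-- The vector representing the degree one part. -/
noncomputable def sharp (hB : Function.Bijective (B : E → Module.Dual A E)) :
    cochains R B S →ₗ[R] E :=
  (((LinearEquiv.ofBijective B hB).symm : Module.Dual A E →ₗ[A] E).restrictScalars R).comp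
    (linearPart R B S)

theorem apply_sharp (hB : Function.Bijective (B : E → Module.Dual A E)) (f : cochains R B S)
    (x : E) : B (sharp R S hB f) x = constTerm R B S (contract R B S x f) :=
  congrArg (fun φ : Module.Dual A E => φ x)
    ((LinearEquiv.ofBijective B hB).apply_symm_apply (linearPart R B S f))

end Words


/-! ### Products determined by their constant term; the wedge product and the bracket. -/

section Convolution

variable {R A E : Type*} [CommRing R] [CommRing A] [Algebra R A]
  [AddCommGroup E] [Module R E] [Module A E] [IsScalarTower R A E]
  {B : LinearMap.BilinForm A E} {S : Finset (E × E)}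

local notation "ι" => contract R B S
local notation "Δ" => scalarContract R B S
local notation "κ" => constTerm R B S
local notation "ε" => involute R B S

/-- The values of the product on cochains with constant term `β` for which insertions of vectors are
graded derivations. -/
def convolutionValue (β : cochains R B S →ₗ[R] cochains R B S →ₗ[R] A) :
    List E → cochains R B S →ₗ[R] cochains R B S →ₗ[R] A
  | [] => β
  | x :: w => (convolutionValue β w).compl₁₂ (ι x) ε +
      (convolutionValue β w).compl₁₂ LinearMap.id (ι x)

/-- The conditions on `β` under which the product with constant term `β` is a cochain. -/
structure IsCochainPairing (β : cochains R B S →ₗ[R] cochains R B S →ₗ[R] A) : Prop where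
  last : ∀ (a : A) (x : E) (f g), β (ι (a • x) f) (ε g) + β f (ι (a • x) g) =
    a * (β (ι x f) (ε g) + β f (ι x g))
  leibniz : ∀ (a b : A) (f g), β (Δ (a * b) f) g + β f (Δ (a * b) g) =
    a * (β (Δ b f) g + β f (Δ b g)) + b * (β (Δ a f) g + β f (Δ a g))

variable {β : cochains R B S →ₗ[R] cochains R B S →ₗ[R] A}

theorem convolutionValue_cons (x : E) (w : List E) (f g : cochains R B S) :
    convolutionValue β (x :: w) f g =
      convolutionValue β w (ι x f) (ε g) + convolutionValue β w f (ι x g) := rfl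

/-- The terms with one insertion in each factor cancel, since insertions anticommute with the
grading involution. What is left are the anticommutators on each factor separately. -/
theorem convolutionValue_cons_cons (x y : E) (w : List E) (f g : cochains R B S) :
    convolutionValue β (x :: y :: w) f g + convolutionValue β (y :: x :: w) f g =
      convolutionValue β w (Δ (B x y) f) g + convolutionValue β w f (Δ (B x y) g) := by
  simp only [convolutionValue_cons, ← contract_anticomm, contract_involute, involute_involute,
    map_add, map_neg, LinearMap.add_apply]
  ring

/-- Being built from anticommutators of odd derivations, `Δ_a` is an even derivation of the product:
no sign and no involution appear. -/
theorem anticommSum_convolutionValue (a : A) (w : List E) (f g : cochains R B S) :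
    anticommSum S a (fun v => convolutionValue β v f g) w =
      convolutionValue β w (Δ a f) g + convolutionValue β w f (Δ a g) := by
  simp only [anticommSum, convolutionValue_cons_cons]
  rw [scalarContract_eq a f, scalarContract_eq a g]
  simp only [contract_anticomm, map_sum, LinearMap.sum_apply, Finset.sum_add_distrib]

/-- The operator relations are inherited from the factors; only the two conditions concerning the
constant term need `hβ`. An insertion into a product is a sum of two products, as the coinduction
principle requires. -/
theorem convolutionValue_mem (hβ : IsCochainPairing β) (f g : cochains R B S) :
    (fun w => convolutionValue β w f g) ∈ cochains R B S := by
  refine subset_cochains (R := R) (Set.range fun (p : cochains R B S × cochains R B S)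
    (w : List E) => convolutionValue β w p.1 p.2) ?_ ?_ ⟨(f, g), rfl⟩
  · rintro _ ⟨⟨f, g⟩, rfl⟩
    refine ⟨fun x y w => ?_, fun r x w => ?_, fun a x => hβ.last a x f g, fun x y w => ?_,
      fun a x w => ?_, fun a b => ?_⟩
    · simp only [convolutionValue_cons, map_add, LinearMap.add_apply]
      ring
    · simp only [convolutionValue_cons, map_smul, LinearMap.smul_apply, smul_add]
    · rw [anticommSum_convolutionValue]
      exact convolutionValue_cons_cons x y w f g
    · rw [anticommSum_convolutionValue]
      simp only [convolutionValue_cons]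
      have h : (fun v => convolutionValue β v (ι x f) (ε g) + convolutionValue β v f (ι x g)) =
        (fun v => convolutionValue β v (ι x f) (ε g)) +
          fun v => convolutionValue β v f (ι x g) := rfl
      rw [h, anticommSum_add, anticommSum_convolutionValue, anticommSum_convolutionValue]
      simp only [scalarContract_contract, scalarContract_involute]
      ring
    · simp only [anticommSum_convolutionValue]
      exact hβ.leibniz a b f g
  · rintro _ ⟨⟨f, g⟩, rfl⟩ x
    exact Submodule.add_mem _ (Submodule.subset_span ⟨(ι x f, ε g), rfl⟩)
      (Submodule.subset_span ⟨(f, ι x g), rfl⟩)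

/-- The product on cochains with constant term `β` for which insertions of vectors are graded
derivations. -/
def convolution (hβ : IsCochainPairing β) :
    cochains R B S →ₗ[R] cochains R B S →ₗ[R] cochains R B S :=
  LinearMap.mk₂ R (fun f g => ⟨fun w => convolutionValue β w f g, convolutionValue_mem hβ f g⟩)
    (fun f f' g => Subtype.ext <| funext fun w => by simp)
    (fun r f g => Subtype.ext <| funext fun w => by simp)
    (fun f g g' => Subtype.ext <| funext fun w => by simp)
    (fun r f g => Subtype.ext <| funext fun w => by simp)

theorem contract_convolution (hβ : IsCochainPairing β) (x : E) (f g : cochains R B S) :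
    ι x (convolution hβ f g) =
      convolution hβ (ι x f) (ε g) + convolution hβ f (ι x g) := rfl

theorem scalarContract_convolution (hβ : IsCochainPairing β) (a : A) (f g : cochains R B S) :
    Δ a (convolution hβ f g) = convolution hβ (Δ a f) g + convolution hβ f (Δ a g) :=
  cochains_ext fun w => by
    rw [scalarContract_apply]
    exact anticommSum_convolutionValue a w f g

theorem involute_convolution (hβ : IsCochainPairing β)
    (h : ∀ f g, β (ε f) (ε g) = β f g) (f g : cochains R B S) :
    ε (convolution hβ f g) = convolution hβ (ε f) (ε g) := by
  suffices h : ∀ (w : List E) (f g : cochains R B S),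
      convolutionValue β w (ε f) (ε g) = (-1 : R) ^ w.length • convolutionValue β w f g from
    cochains_ext fun w => (h w f g).symm
  intro w
  induction w with
  | nil => intro f g; simpa [convolutionValue] using h f g
  | cons x w ih =>
    intro f g
    simp only [convolutionValue_cons, contract_involute, map_neg, LinearMap.neg_apply, ih,
      List.length_cons, pow_succ]
    simp only [mul_neg, mul_one, smul_add, neg_smul]

theorem isHomogeneousCochain_convolution (hβ : IsCochainPairing β) {k : ℤ}
    (h : ∀ (m n : ℤ) (f g), IsHomogeneousCochain R B S m f → IsHomogeneousCochain R B S n g →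
      m + n + k ≠ 0 → β f g = 0) {m n : ℤ} {f g : cochains R B S}
    (hf : IsHomogeneousCochain R B S m f) (hg : IsHomogeneousCochain R B S n g) :
    IsHomogeneousCochain R B S (m + n + k) (convolution hβ f g) := by
  intro w
  change _ → convolutionValue β w f g = 0
  induction w generalizing m n f g with
  | nil => exact fun hw => h m n f g hf hg fun h' => hw (by simp [h'])
  | cons x w ih =>
    intro hw
    simp only [List.length_cons, Nat.cast_succ] at hw
    rw [convolutionValue_cons, hg.involute_eq, map_smul, ih (hf.contract x) hg (by omega),
      ih hf (hg.contract x) (by omega), smul_zero, add_zero]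

variable (R B S) in
/-- The constant term of the wedge product. -/
def wedgePairing : cochains R B S →ₗ[R] cochains R B S →ₗ[R] A :=
  (LinearMap.mul R A).compl₁₂ κ κ

theorem wedgePairing_apply (f g : cochains R B S) : wedgePairing R B S f g = κ f * κ g := rfl

theorem isCochainPairing_wedgePairing : IsCochainPairing (wedgePairing R B S) := by
  constructor
  · intro a x f g
    simp only [wedgePairing_apply, constTerm_contract_smul]
    ring
  · intro a b f g
    simp only [wedgePairing_apply, constTerm_scalarContract_mul]
    ring

variable (R B S) in
/-- The wedge product of cochains. -/
def cochainWedge : cochains R B S →ₗ[R] cochains R B S →ₗ[R] cochains R B S :=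
  convolution isCochainPairing_wedgePairing

section Bracket

variable (hB : Function.Bijective (B : E → Module.Dual A E))

theorem sharp_involute (f : cochains R B S) : sharp R S hB (ε f) = -sharp R S hB f := by
  refine hB.1 (LinearMap.ext fun x => ?_)
  rw [apply_sharp, contract_involute, map_neg, constTerm_involute, map_neg, LinearMap.neg_apply,
    apply_sharp]

/-- Exchanging the two insertions costs a symbol term but makes `x` the letter inserted last, where
the constant term is `A`-linear. -/
theorem apply_sharp_contract (f : cochains R B S) (x y : E) :
    B (sharp R S hB (ι x f)) y = κ (Δ (B x y) f) - κ (ι x (ι y f)) := by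
  rw [apply_sharp, ← contract_anticomm, map_add]
  ring

variable (R S) in
/-- The constant term of the bracket. -/
noncomputable def bracketPairing : cochains R B S →ₗ[R] cochains R B S →ₗ[R] A :=
  LinearMap.mk₂ R (fun f g => κ (Δ (κ g) f) - κ (Δ (κ f) g) + B (sharp R S hB f) (sharp R S hB g))
    (fun f f' g => by simp only [map_add, LinearMap.add_apply]; ring)
    (fun r f g => by
      simp only [map_smul, LinearMap.smul_apply, LinearMap.map_smul_of_tower, smul_sub, smul_add])
    (fun f g g' => by simp only [map_add, LinearMap.add_apply]; ring)
    (fun r f g => by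
      simp only [map_smul, LinearMap.smul_apply, LinearMap.map_smul_of_tower, smul_sub, smul_add])

theorem bracketPairing_apply (f g : cochains R B S) : bracketPairing R S hB f g =
    κ (Δ (κ g) f) - κ (Δ (κ f) g) + B (sharp R S hB f) (sharp R S hB g) := rfl

theorem bracketPairing_involute (f g : cochains R B S) :
    bracketPairing R S hB (ε f) (ε g) = bracketPairing R S hB f g := by
  simp only [bracketPairing_apply, sharp_involute, constTerm_involute, scalarContract_involute,
    map_neg, LinearMap.neg_apply, neg_neg]

variable (hsymm : ∀ x y, B x y = B y x)
include hsymm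

theorem apply_sharp_right (f : cochains R B S) (x : E) : B x (sharp R S hB f) = κ (ι x f) := by
  rw [hsymm, apply_sharp]

/-- The terms inserting the scalars `κ(ι_x f)` and `κ(ι_x g)` are not `A`-linear in `x`, but they
cancel in pairs; in every other term `x` is inserted last. -/
theorem bracketPairing_contract (f g : cochains R B S) (x : E) :
    bracketPairing R S hB (ι x f) (ε g) + bracketPairing R S hB f (ι x g) =
      κ (ι x (Δ (κ g) f)) - κ (Δ (κ (ι x f)) g) - κ (Δ (κ (ι x g)) f) +
          κ (ι x (ι (sharp R S hB g) f)) + κ (Δ (κ (ι x g)) f) - κ (ι x (Δ (κ f) g)) +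
        κ (Δ (κ (ι x f)) g) - κ (ι x (ι (sharp R S hB f) g)) := by
  rw [bracketPairing_apply, bracketPairing_apply, sharp_involute, map_neg, apply_sharp_contract,
    hsymm (sharp R S hB f) (sharp R S hB (ι x g)), apply_sharp_contract]
  simp only [constTerm_involute, scalarContract_involute, apply_sharp_right hB hsymm,
    scalarContract_contract]
  ring

/-- The first condition is the cancellation in `bracketPairing_contract`. For the second, most terms
have the form `κ Δ_c F` with `F` independent of `c`; the other two form the commutator of the
derivations `c ↦ κ Δ_c f` and `c ↦ κ Δ_c g`, again a derivation. -/
theorem isCochainPairing_bracketPairing : IsCochainPairing (bracketPairing R S hB) := by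
  constructor
  · intro a x f g
    simp only [bracketPairing_contract hB hsymm, constTerm_contract_smul,
      constTerm_scalarContract_mul]
    ring
  · intro a b f g
    have h1 : ∀ c, B (sharp R S hB (Δ c f)) (sharp R S hB g) = κ (Δ c (ι (sharp R S hB g) f)) :=
      fun c => by rw [apply_sharp, scalarContract_contract]
    have h2 : ∀ c, B (sharp R S hB f) (sharp R S hB (Δ c g)) = κ (Δ c (ι (sharp R S hB f) g)) :=
      fun c => by rw [apply_sharp_right hB hsymm, scalarContract_contract]
    simp only [bracketPairing_apply, h1, h2]
    simp only [scalarContract_comm (κ g) _ f, scalarContract_comm (κ f) _ g,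
      constTerm_scalarContract_mul, map_add, LinearMap.add_apply]
    ring

variable (R S) in
/-- The bracket of cochains. -/
noncomputable def cochainBracket : cochains R B S →ₗ[R] cochains R B S →ₗ[R] cochains R B S :=
  convolution (isCochainPairing_bracketPairing hB hsymm)

end Bracket

end Convolution


/-! ### Graded identities of the wedge product and the bracket on cochains. -/

section Identities

variable {R A E : Type*} [CommRing R] [CommRing A] [Algebra R A]
  [AddCommGroup E] [Module R E] [Module A E] [IsScalarTower R A E]
  {B : LinearMap.BilinForm A E} {S : Finset (E × E)}

local notation "ι" => contract R B S
local notation "Δ" => scalarContract R B S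
local notation "κ" => constTerm R B S
local notation "ε" => involute R B S

theorem contract_cochainWedge (x : E) (f g : cochains R B S) :
    ι x (cochainWedge R B S f g) =
      cochainWedge R B S (ι x f) (ε g) + cochainWedge R B S f (ι x g) :=
  contract_convolution _ x f g

theorem scalarContract_cochainWedge (a : A) (f g : cochains R B S) :
    Δ a (cochainWedge R B S f g) =
      cochainWedge R B S (Δ a f) g + cochainWedge R B S f (Δ a g) :=
  scalarContract_convolution _ a f g

theorem involute_cochainWedge (f g : cochains R B S) :
    ε (cochainWedge R B S f g) = cochainWedge R B S (ε f) (ε g) :=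
  involute_convolution _ (fun f g => by simp only [wedgePairing_apply, constTerm_involute]) f g

theorem constTerm_cochainWedge (f g : cochains R B S) :
    κ (cochainWedge R B S f g) = κ f * κ g := rfl

theorem isHomogeneousCochain_cochainWedge {m n : ℤ} {f g : cochains R B S}
    (hf : IsHomogeneousCochain R B S m f) (hg : IsHomogeneousCochain R B S n g) :
    IsHomogeneousCochain R B S (m + n) (cochainWedge R B S f g) := by
  rw [← add_zero (m + n)]
  refine isHomogeneousCochain_convolution isCochainPairing_wedgePairing ?_ hf hg
  intro m n f g hf hg h
  rw [wedgePairing_apply]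
  by_cases hm : m = 0
  · rw [hg.constTerm_eq_zero (by omega), mul_zero]
  · rw [hf.constTerm_eq_zero hm, zero_mul]

theorem cochainWedge_assoc (f g h : cochains R B S) :
    cochainWedge R B S (cochainWedge R B S f g) h =
      cochainWedge R B S f (cochainWedge R B S g h) := by
  refine cochains_ext fun w => ?_
  induction w generalizing f g h with
  | nil => exact mul_assoc (κ f) (κ g) (κ h)
  | cons x w ih =>
    simp only [← contract_apply, contract_cochainWedge, involute_cochainWedge, map_add,
      LinearMap.add_apply, Submodule.coe_add, Pi.add_apply, ih]
    ring

theorem cochainWedge_comm {m n : ℤ} {f g : cochains R B S}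
    (hf : IsHomogeneousCochain R B S m f) (hg : IsHomogeneousCochain R B S n g) :
    cochainWedge R B S f g = gradedSign R (m * n) • cochainWedge R B S g f := by
  refine cochains_ext fun w => ?_
  induction w generalizing m n f g with
  | nil =>
    change κ f * κ g = gradedSign R (m * n) • (κ g * κ f)
    by_cases hm : m = 0
    · rw [hm, zero_mul, gradedSign_even Even.zero, one_smul, mul_comm]
    · rw [hf.constTerm_eq_zero hm, zero_mul, mul_zero, smul_zero]
  | cons x w ih =>
    have h1 := ih (hf.contract x) hg
    have h2 := ih hf (hg.contract x)
    have hn := congrArg (algebraMap R A) (gradedSign_mul_self (R := R) n)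
    simp only [sub_mul, mul_sub, one_mul, mul_one, gradedSign_sub, map_mul, map_one,
      Submodule.coe_smul, Pi.smul_apply] at h1 h2 hn
    simp only [Algebra.smul_def, map_mul] at h1 h2 hn
    simp only [← contract_apply, contract_cochainWedge, map_smul, hf.involute_eq, hg.involute_eq,
      Submodule.coe_add, Pi.add_apply, Submodule.coe_smul, Pi.smul_apply]
    simp only [Algebra.smul_def]
    -- Passing `x` across the right factor gives the sign `(-1)^n`; lowering `m` by one in
    -- `(-1)^(mn)` gives it a second time, and `hn` removes the square.
    linear_combination algebraMap R A (gradedSign R n) * h1 + h2 +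
      algebraMap R A (gradedSign R (m * n)) * (cochainWedge R B S g (ι x f)).1 w * hn

section Bracket

variable (hB : Function.Bijective (B : E → Module.Dual A E)) (hsymm : ∀ x y, B x y = B y x)

theorem contract_cochainBracket (x : E) (f g : cochains R B S) :
    ι x (cochainBracket R S hB hsymm f g) =
      cochainBracket R S hB hsymm (ι x f) (ε g) + cochainBracket R S hB hsymm f (ι x g) :=
  contract_convolution _ x f g

theorem scalarContract_cochainBracket (a : A) (f g : cochains R B S) :
    Δ a (cochainBracket R S hB hsymm f g) =
      cochainBracket R S hB hsymm (Δ a f) g + cochainBracket R S hB hsymm f (Δ a g) :=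
  scalarContract_convolution _ a f g

theorem involute_cochainBracket (f g : cochains R B S) :
    ε (cochainBracket R S hB hsymm f g) = cochainBracket R S hB hsymm (ε f) (ε g) :=
  involute_convolution _ (fun f g => bracketPairing_involute hB f g) f g

theorem constTerm_cochainBracket (f g : cochains R B S) :
    κ (cochainBracket R S hB hsymm f g) =
      κ (Δ (κ g) f) - κ (Δ (κ f) g) + B (sharp R S hB f) (sharp R S hB g) := rfl

theorem IsHomogeneousCochain.sharp_eq_zero {n : ℤ} {f : cochains R B S}
    (h : IsHomogeneousCochain R B S n f) (hn : n ≠ 1) : sharp R S hB f = 0 := by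
  refine hB.1 (LinearMap.ext fun x => ?_)
  rw [apply_sharp, (h.contract x).constTerm_eq_zero (by omega), map_zero, LinearMap.zero_apply]

theorem isHomogeneousCochain_cochainBracket {m n : ℤ} {f g : cochains R B S}
    (hf : IsHomogeneousCochain R B S m f) (hg : IsHomogeneousCochain R B S n g) :
    IsHomogeneousCochain R B S (m + n - 2) (cochainBracket R S hB hsymm f g) := by
  refine isHomogeneousCochain_convolution (isCochainPairing_bracketPairing hB hsymm) (k := -2)
    ?_ hf hg
  intro m n f g hf hg h
  rw [bracketPairing_apply]
  have h1 : κ (Δ (κ g) f) = 0 := by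
    by_cases hn : n = 0
    · exact (hf.scalarContract _).constTerm_eq_zero (by omega)
    · rw [hg.constTerm_eq_zero hn, map_zero, LinearMap.zero_apply, map_zero]
  have h2 : κ (Δ (κ f) g) = 0 := by
    by_cases hm : m = 0
    · exact (hg.scalarContract _).constTerm_eq_zero (by omega)
    · rw [hf.constTerm_eq_zero hm, map_zero, LinearMap.zero_apply, map_zero]
  have h3 : B (sharp R S hB f) (sharp R S hB g) = 0 := by
    by_cases hm : m = 1
    · rw [hg.sharp_eq_zero hB (by omega), map_zero]
    · rw [hf.sharp_eq_zero hB hm, map_zero, LinearMap.zero_apply]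
  rw [h1, h2, h3, sub_zero, add_zero]

theorem cochainBracket_skew {m n : ℤ} {f g : cochains R B S}
    (hf : IsHomogeneousCochain R B S m f) (hg : IsHomogeneousCochain R B S n g) :
    cochainBracket R S hB hsymm f g =
      -(gradedSign R (m * n) • cochainBracket R S hB hsymm g f) := by
  refine cochains_ext fun w => ?_
  induction w generalizing m n f g with
  | nil =>
    change κ (cochainBracket R S hB hsymm f g) =
      -(gradedSign R (m * n) • κ (cochainBracket R S hB hsymm g f))
    simp only [constTerm_cochainBracket, hsymm (sharp R S hB g)]
    -- For even `m` one has `f♯ = 0`, and the scalar terms are antisymmetric. For odd `m` the scalar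
    -- terms vanish, leaving the symmetric `⟨f♯,g♯⟩`, which is nonzero only for odd `n`, where the
    -- sign is `-1`.
    rcases Int.even_or_odd m with hm | hm
    · rw [gradedSign_even (hm.mul_right n), hf.sharp_eq_zero hB (by rintro rfl; simp at hm),
        map_zero, LinearMap.zero_apply, one_smul]
      ring
    · have hf0 := hf.constTerm_eq_zero (by rintro rfl; simp at hm)
      have hf1 : ∀ a, κ (Δ a f) = 0 := fun a => (hf.scalarContract a).constTerm_eq_zero
        (by intro h; obtain rfl : m = 2 := by omega
            exact absurd hm (by decide))
      rcases Int.even_or_odd n with hn | hn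
      · rw [hg.sharp_eq_zero hB (by rintro rfl; simp at hn)]
        simp [hf0, hf1]
      · have hg0 := hg.constTerm_eq_zero (by rintro rfl; simp at hn)
        rw [gradedSign_odd (hm.mul hn)]
        simp [hf0, hg0]
  | cons x w ih =>
    have h1 := ih (hf.contract x) hg
    have h2 := ih hf (hg.contract x)
    have hn := congrArg (algebraMap R A) (gradedSign_mul_self (R := R) n)
    simp only [sub_mul, mul_sub, one_mul, mul_one, gradedSign_sub, map_mul, map_one,
      Submodule.coe_smul, Submodule.coe_neg, Pi.neg_apply, Pi.smul_apply] at h1 h2 hn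
    simp only [Algebra.smul_def, map_mul] at h1 h2 hn
    simp only [← contract_apply, contract_cochainBracket, map_neg, map_smul, hf.involute_eq,
      hg.involute_eq, Submodule.coe_add, Pi.add_apply, Submodule.coe_smul,
      Submodule.coe_neg, Pi.neg_apply, Pi.smul_apply]
    simp only [Algebra.smul_def]
    linear_combination algebraMap R A (gradedSign R n) * h1 + h2 -
      algebraMap R A (gradedSign R (m * n)) * (cochainBracket R S hB hsymm g (ι x f)).1 w * hn

theorem IsHomogeneousCochain.constTerm_scalarContract_eq_zero {n : ℤ} {f : cochains R B S}
    (h : IsHomogeneousCochain R B S n f) (hn : n ≠ 2) (a : A) : κ (Δ a f) = 0 :=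
  (h.scalarContract a).constTerm_eq_zero (by omega)

/-- On constant terms this is the Leibniz rule for `κ Δ_a` and `κ ι_x` on `g ∧ h`, together with
that of `κ Δ_a f` in `a`. The sign is harmless there: `κ g = 0` unless `n = 0`. -/
theorem cochainBracket_wedge {m n : ℤ} {f g : cochains R B S} (h : cochains R B S)
    (hf : IsHomogeneousCochain R B S m f) (hg : IsHomogeneousCochain R B S n g) :
    cochainBracket R S hB hsymm f (cochainWedge R B S g h) =
      cochainWedge R B S (cochainBracket R S hB hsymm f g) h +
        gradedSign R (m * n) • cochainWedge R B S g (cochainBracket R S hB hsymm f h) := by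
  refine cochains_ext fun w => ?_
  induction w generalizing m n f g h with
  | nil =>
    change κ (cochainBracket R S hB hsymm f (cochainWedge R B S g h)) =
      κ (cochainBracket R S hB hsymm f g) * κ h +
        gradedSign R (m * n) • (κ g * κ (cochainBracket R S hB hsymm f h))
    simp only [constTerm_cochainBracket, apply_sharp_right hB hsymm, contract_cochainWedge,
      scalarContract_cochainWedge, map_add, constTerm_cochainWedge, constTerm_scalarContract_mul,
      constTerm_involute]
    by_cases hn : n = 0
    · rw [hn, mul_zero, gradedSign_even Even.zero, one_smul]
      ring
    · rw [hg.constTerm_eq_zero hn]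
      simp
      ring
  | cons x w ih =>
    have h1 := ih (ε h) (hf.contract x) hg
    have h2 := ih (ε h) hf (hg.contract x)
    have h3 := ih (ι x h) hf hg
    have hn := congrArg (algebraMap R A) (gradedSign_mul_self (R := R) n)
    simp only [sub_mul, mul_sub, one_mul, mul_one, gradedSign_sub, map_mul, map_one,
      Submodule.coe_smul, Submodule.coe_add, Pi.add_apply, Pi.smul_apply] at h1 h2 h3 hn
    simp only [Algebra.smul_def, map_mul] at h1 h2 h3 hn
    simp only [← contract_apply, contract_cochainBracket, contract_cochainWedge,
      involute_cochainBracket, involute_cochainWedge, map_add, LinearMap.add_apply, map_smul,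
      hf.involute_eq, hg.involute_eq, LinearMap.smul_apply, Submodule.coe_add, Pi.add_apply,
      Submodule.coe_smul, Pi.smul_apply]
    simp only [Algebra.smul_def]
    linear_combination algebraMap R A (gradedSign R n) * h1 + h2 + h3 +
      algebraMap R A (gradedSign R (m * n)) *
        (cochainWedge R B S g (cochainBracket R S hB hsymm (ι x f) (ε h))).1 w * hn

theorem constTerm_contract_cochainBracket (x : E) (f g : cochains R B S) :
    κ (ι x (cochainBracket R S hB hsymm f g)) =
      κ (ι x (Δ (κ g) f)) - κ (Δ (κ (ι x f)) g) + κ (ι x (ι (sharp R S hB g) f)) -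
        κ (ι x (Δ (κ f) g)) + κ (Δ (κ (ι x f)) g) - κ (ι x (ι (sharp R S hB f) g)) := by
  refine (bracketPairing_contract hB hsymm f g x).trans ?_
  ring

theorem constTerm_scalarContract_cochainBracket (a : A) (f g : cochains R B S) :
    κ (Δ a (cochainBracket R S hB hsymm f g)) =
      κ (Δ a (Δ (κ g) f)) - κ (Δ (κ (Δ a f)) g) + κ (ι (sharp R S hB g) (Δ a f)) +
        κ (Δ (κ (Δ a g)) f) - κ (Δ a (Δ (κ f) g)) + κ (ι (sharp R S hB f) (Δ a g)) := by
  rw [scalarContract_cochainBracket, map_add, constTerm_cochainBracket, constTerm_cochainBracket,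
    apply_sharp, apply_sharp_right hB hsymm, scalarContract_comm (κ g), scalarContract_comm (κ f)]
  ring

/-- Everything expands into constant terms of at most two successive insertions into one of `f`,
`g`, `h`. Parity of `m` and `n` then removes the terms that would carry a wrong sign, and the rest
cancels because the `Δ`'s commute. -/
theorem cochainBracket_jacobi_nil {m n : ℤ} {f g : cochains R B S} (h : cochains R B S)
    (hf : IsHomogeneousCochain R B S m f) (hg : IsHomogeneousCochain R B S n g) :
    κ (cochainBracket R S hB hsymm f (cochainBracket R S hB hsymm g h)) =
      κ (cochainBracket R S hB hsymm (cochainBracket R S hB hsymm f g) h) +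
        gradedSign R (m * n) •
          κ (cochainBracket R S hB hsymm g (cochainBracket R S hB hsymm f h)) := by
  have hl : ∀ f g h : cochains R B S,
      κ (cochainBracket R S hB hsymm f (cochainBracket R S hB hsymm g h)) =
        κ (Δ (κ (cochainBracket R S hB hsymm g h)) f) -
          κ (Δ (κ f) (cochainBracket R S hB hsymm g h)) +
          κ (ι (sharp R S hB f) (cochainBracket R S hB hsymm g h)) := fun f g h => by
    rw [constTerm_cochainBracket _ _ f, apply_sharp_right hB hsymm]
  have hr : κ (cochainBracket R S hB hsymm (cochainBracket R S hB hsymm f g) h) =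
        κ (Δ (κ h) (cochainBracket R S hB hsymm f g)) -
          κ (Δ (κ (cochainBracket R S hB hsymm f g)) h) +
          κ (ι (sharp R S hB h) (cochainBracket R S hB hsymm f g)) := by
    rw [constTerm_cochainBracket _ _ _ h, apply_sharp]
  -- A symbol applied to an inner product of vectors is an anticommutator of insertions; this and
  -- `h2` bring all terms to a common normal form.
  have h1 : ∀ F f g : cochains R B S, κ (Δ (B (sharp R S hB f) (sharp R S hB g)) F) =
      κ (ι (sharp R S hB f) (ι (sharp R S hB g) F)) +
        κ (ι (sharp R S hB g) (ι (sharp R S hB f) F)) := fun F f g => by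
    rw [← contract_anticomm, map_add, add_comm]
  have h2 : ∀ F f g : cochains R B S, κ (Δ (κ (ι (sharp R S hB f) g)) F) =
      κ (ι (sharp R S hB f) (ι (sharp R S hB g) F)) +
        κ (ι (sharp R S hB g) (ι (sharp R S hB f) F)) := fun F f g => by
    rw [← apply_sharp_right hB hsymm, h1]
  -- Vector insertions lower the degree by one and scalar insertions by two, so a constant term
  -- survives only if the parities match.
  have hodd : ∀ {m : ℤ} {f : cochains R B S}, IsHomogeneousCochain R B S m f → Odd m →
      κ f = 0 ∧ (∀ a, κ (Δ a f) = 0) ∧ (∀ a b, κ (Δ a (Δ b f)) = 0) ∧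
        ∀ x y, κ (ι x (ι y f)) = 0 := by
    intro m f hf hm
    obtain ⟨l, rfl⟩ := hm
    exact ⟨hf.constTerm_eq_zero (by omega), hf.constTerm_scalarContract_eq_zero (by omega),
      fun a b => (hf.scalarContract b).constTerm_scalarContract_eq_zero (by omega) a,
      fun x y => ((hf.contract y).contract x).constTerm_eq_zero (by omega)⟩
  have heven : ∀ {m : ℤ} {f : cochains R B S}, IsHomogeneousCochain R B S m f → Even m →
      sharp R S hB f = 0 ∧ ∀ a x, κ (ι x (Δ a f)) = 0 := by
    intro m f hf hm
    obtain ⟨l, rfl⟩ := hm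
    exact ⟨hf.sharp_eq_zero hB (by omega),
      fun a x => ((hf.scalarContract a).contract x).constTerm_eq_zero (by omega)⟩
  rw [hl, hl, hr]
  simp only [constTerm_contract_cochainBracket, constTerm_scalarContract_cochainBracket,
    constTerm_cochainBracket, map_add, map_sub, LinearMap.add_apply, LinearMap.sub_apply,
    h1, h2]
  rw [scalarContract_comm (κ h) (κ g) f, scalarContract_comm (κ h) (κ f) g,
    scalarContract_comm (κ g) (κ f) h]
  rcases Int.even_or_odd m with hm | hm
  · obtain ⟨hp, hf1⟩ := heven hf hm
    simp only [gradedSign_even (hm.mul_right n), one_smul, hp, hf1, map_zero, LinearMap.zero_apply]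
    rcases Int.even_or_odd n with hn | hn
    · obtain ⟨hq, hg1⟩ := heven hg hn
      simp only [hq, hg1, map_zero, LinearMap.zero_apply]
      ring
    · obtain ⟨hg0, hg1, hg2, -⟩ := hodd hg hn
      simp only [hg0, hg1, hg2, map_zero, LinearMap.zero_apply]
      ring
  · obtain ⟨hf0, hf1, hf2, hf3⟩ := hodd hf hm
    rcases Int.even_or_odd n with hn | hn
    · obtain ⟨hq, hg1⟩ := heven hg hn
      simp only [gradedSign_even (hn.mul_left m), one_smul, hf0, hf1, hf2, hq, hg1, map_zero,
        LinearMap.zero_apply]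
      ring
    · obtain ⟨hg0, hg1, -, hg3⟩ := hodd hg hn
      simp only [gradedSign_odd (hm.mul hn), neg_smul, one_smul, hf0, hf1, hf3, hg0, hg1,
        hg3, map_zero, LinearMap.zero_apply]
      ring

theorem cochainBracket_jacobi {m n k : ℤ} {f g h : cochains R B S}
    (hf : IsHomogeneousCochain R B S m f) (hg : IsHomogeneousCochain R B S n g)
    (hh : IsHomogeneousCochain R B S k h) :
    cochainBracket R S hB hsymm f (cochainBracket R S hB hsymm g h) =
      cochainBracket R S hB hsymm (cochainBracket R S hB hsymm f g) h +
        gradedSign R (m * n) •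
          cochainBracket R S hB hsymm g (cochainBracket R S hB hsymm f h) := by
  refine cochains_ext fun w => ?_
  induction w generalizing m n k f g h with
  | nil => exact cochainBracket_jacobi_nil hB hsymm h hf hg
  | cons x w ih =>
    have h1 := ih (hf.contract x) hg hh
    have h2 := ih hf (hg.contract x) hh
    have h3 := ih hf hg (hh.contract x)
    have hn := congrArg (algebraMap R A) (gradedSign_mul_self (R := R) n)
    simp only [sub_mul, mul_sub, one_mul, mul_one, gradedSign_sub, map_mul, map_one,
      Submodule.coe_smul, Submodule.coe_add, Pi.add_apply, Pi.smul_apply] at h1 h2 h3 hn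
    simp only [Algebra.smul_def, map_mul] at h1 h2 h3 hn
    simp only [← contract_apply, contract_cochainBracket,
      involute_cochainBracket, map_add, LinearMap.add_apply, map_smul,
      hf.involute_eq, hg.involute_eq, hh.involute_eq, LinearMap.smul_apply, Submodule.coe_add,
      Pi.add_apply, Submodule.coe_smul, Pi.smul_apply]
    simp only [Algebra.smul_def]
    -- One induction hypothesis for each argument receiving `x`, weighted by the signs `(-1)^n`,
    -- `(-1)^k` of the arguments to its right.
    linear_combination algebraMap R A (gradedSign R n) * algebraMap R A (gradedSign R k) * h1 +
      algebraMap R A (gradedSign R k) * h2 + h3 +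
      algebraMap R A (gradedSign R k) * algebraMap R A (gradedSign R (m * n)) *
        (cochainBracket R S hB hsymm g (cochainBracket R S hB hsymm (ι x f) h)).1 w * hn

end Bracket

end Identities


/-! ### Components of `𝒞^•(E)` as homogeneous cochains. -/

section Realization

variable {R : Type v} {A E : Type u} [CommRing R] [CommRing A] [Algebra R A]
  [AddCommGroup E] [Module R E] [Module A E] [IsScalarTower R A E]
  {B : LinearMap.BilinForm A E} {S : Finset (E × E)}

/-- Insertion of `x` in the first argument, as a map between the components. -/
def insertComponent (x : E) : ∀ r, Component R B (r + 1) →ₗ[R] Component R B r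
  | 0 =>
    { toFun := fun y : E => (B y x : A)
      map_add' := fun y z : E => (by simp : B (y + z) x = B y x + B z x)
      map_smul' := fun (r : R) (y : E) =>
        (by rw [LinearMap.map_smul_of_tower]; rfl : B (r • y) x = r • B y x) }
  | 1 =>
    { toFun := fun D : multibrackets R B 0 => (D.1 fun _ => x : E)
      map_add' := fun _ _ => rfl
      map_smul' := fun _ _ => rfl }
  | n + 2 =>
    { toFun := fun C : multibrackets R B (n + 1) => insertFirst x C
      map_add' := fun _ _ => rfl
      map_smul' := fun _ _ => rfl }

theorem insertComponent_add (x y : E) : ∀ (r : ℕ) (c : Component R B (r + 1)),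
    insertComponent (x + y) r c = insertComponent x r c + insertComponent y r c
  | 0, c => (B c).map_add x y
  | 1, D => by
    let D' : multibrackets R B 0 := D
    have h := D'.1.map_update_add (fun _ => x) 0 x y
    have hu : ∀ z : E, Function.update (fun _ : Fin 1 => x) 0 z = fun _ => z :=
      fun z => funext fun i => by rw [Fin.fin_one_eq_zero i, Function.update_self]
    rw [hu, hu, hu] at h
    exact h
  | n + 2, C => Subtype.ext ((C : multibrackets R B (n + 1)).1.curryLeft.map_add x y)

theorem insertComponent_smul (a : R) (x : E) : ∀ (r : ℕ) (c : Component R B (r + 1)),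
    insertComponent (a • x) r c = a • insertComponent x r c
  | 0, c => (B c).map_smul_of_tower a x
  | 1, D => by
    let D' : multibrackets R B 0 := D
    have h := D'.1.map_update_smul (fun _ => x) 0 a x
    have hu : ∀ z : E, Function.update (fun _ : Fin 1 => x) 0 z = fun _ => z :=
      fun z => funext fun i => by rw [Fin.fin_one_eq_zero i, Function.update_self]
    rw [hu, hu] at h
    exact h
  | n + 2, C => Subtype.ext ((C : multibrackets R B (n + 1)).1.curryLeft.map_smul a x)

theorem insertComponent_injective : ∀ (r : ℕ) (c : Component R B (r + 1)),
    Function.Injective (B : E → Module.Dual A E) →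
    (∀ x, insertComponent x r c = 0) → c = 0
  | 0, c, hB, h => hB (LinearMap.ext fun x => (h x).trans (by simp : (0 : A) = B 0 x))
  | 1, D, _, h => by
    refine Subtype.ext (MultilinearMap.ext fun y => ?_)
    have h1 : y = fun _ => y 0 := funext fun i => by rw [Fin.fin_one_eq_zero i]
    rw [h1]
    exact h (y 0)
  | n + 2, C, _, h => by
    refine Subtype.ext (MultilinearMap.ext fun y => ?_)
    have h1 := congrArg (fun C' : multibrackets R B n => C'.1 (Fin.tail y)) (h (y 0))
    change (C : multibrackets R B (n + 1)).1 (Fin.cons (y 0) (Fin.tail y)) = _ at h1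
    rwa [Fin.cons_self_tail] at h1

/-- An element of `𝒞^(n+2)(E)`, regarded as an element of the component of degree `n + 2`. -/
def componentOfMap {n : ℕ} (C : multibrackets R B n) : Component R B (n + 2) := C

/-- The value of the word function of an element of a component. -/
def componentValue : ∀ r : ℕ, Component R B r → List E → A
  | 0, a, [] => a
  | 0, _, _ :: _ => 0
  | _ + 1, _, [] => 0
  | r + 1, c, x :: w => componentValue r (insertComponent x r c) w

theorem componentValue_eq_zero : ∀ (r : ℕ) (c : Component R B r) (w : List E),
    w.length ≠ r → componentValue r c w = 0
  | 0, _, [], h => (h rfl).elim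
  | 0, _, _ :: _, _ => rfl
  | _ + 1, _, [], _ => rfl
  | r + 1, c, x :: w, h => componentValue_eq_zero r _ w fun h' => h (by simp [h'])

theorem componentValue_add : ∀ (r : ℕ) (c d : Component R B r) (w : List E),
    componentValue r (c + d) w = componentValue r c w + componentValue r d w
  | 0, _, _, [] => rfl
  | 0, _, _, _ :: _ => (add_zero _).symm
  | _ + 1, _, _, [] => (add_zero _).symm
  | r + 1, c, d, x :: w => by
    simp only [componentValue, map_add]
    exact componentValue_add r _ _ w

theorem componentValue_smul (a : R) : ∀ (r : ℕ) (c : Component R B r) (w : List E),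
    componentValue r (a • c) w = a • componentValue r c w
  | 0, _, [] => rfl
  | 0, _, _ :: _ => (smul_zero _).symm
  | _ + 1, _, [] => (smul_zero _).symm
  | r + 1, c, x :: w => by
    simp only [componentValue, map_smul]
    exact componentValue_smul a r _ w

/-- The symbol of an element of `𝒞^(n+2)(E)` as a function on words. -/
noncomputable def symbolValue : ∀ n : ℕ, multibrackets R B n → List E → Derivation R A A
  | 0, D, [] => symbol D Fin.elim0
  | 0, _, _ :: _ => 0
  | _ + 1, _, [] => 0
  | n + 1, C, x :: w => symbolValue n (insertFirst x C) w

theorem symbolValue_eq_zero : ∀ (n : ℕ) (C : multibrackets R B n) (w : List E),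
    w.length ≠ n → symbolValue n C w = 0
  | 0, _, [], h => (h rfl).elim
  | 0, _, _ :: _, _ => rfl
  | _ + 1, _, [], _ => rfl
  | n + 1, C, x :: w, h => symbolValue_eq_zero n _ w fun h' => h (by simp [h'])

theorem componentValue_ofFn (n : ℕ) (C : multibrackets R B n) (y : Fin (n + 1) → E) (z : E) :
    componentValue (n + 2) (componentOfMap C) (List.ofFn y ++ [z]) = B (C.1 y) z := by
  induction n with
  | zero =>
    have h1 : y = fun _ => y 0 := funext fun i => by rw [Fin.fin_one_eq_zero i]
    rw [h1]
    rfl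
  | succ n ih =>
    rw [List.ofFn_succ]
    refine (ih (insertFirst (y 0) C) (Fin.tail y)).trans ?_
    change B (C.1 (Fin.cons (y 0) (Fin.tail y))) z = _
    rw [Fin.cons_self_tail]

section Full

variable (hfull : Function.Surjective (TensorProduct.lift B))
include hfull

/-- `symbol` is a mere choice, so this needs fullness: both sides obey the same formula on inner
products, and these generate `A` additively. -/
theorem symbol_insertFirst {n : ℕ} (x : E) (C : multibrackets R B (n + 1)) :
    symbol (insertFirst x C) = (symbol C).curryLeft x := by
  ext y a
  obtain ⟨t, rfl⟩ := hfull a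
  induction t using TensorProduct.induction_on with
  | zero => simp
  | tmul u w =>
    have h1 := (symbol_spec C).der (Fin.cons x y) u w
    rw [TensorProduct.lift.tmul, (symbol_spec (insertFirst x C)).der,
      MultilinearMap.curryLeft_apply, h1, ← Fin.cons_snoc_eq_snoc_cons,
      ← Fin.cons_snoc_eq_snoc_cons]
    rfl
  | add s t hs ht => simp only [map_add, hs, ht]

theorem symbolValue_ofFn (n : ℕ) (C : multibrackets R B n) (y : Fin n → E) :
    symbolValue n C (List.ofFn y) = symbol C y := by
  induction n with
  | zero =>
    rw [Subsingleton.elim y Fin.elim0]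
    rfl
  | succ n ih =>
    rw [List.ofFn_succ]
    refine (ih (insertFirst (y 0) C) (Fin.tail y)).trans ?_
    rw [symbol_insertFirst hfull, MultilinearMap.curryLeft_apply, Fin.cons_self_tail]

/-- Both defining axioms become one relation on words: `der` when nothing follows `x, y`, and `symm`
at the first position otherwise. -/
theorem componentValue_cons_cons (hsymm : ∀ x y, B x y = B y x) (n : ℕ) (C : multibrackets R B n)
    (x y : E) (w : List E) :
    componentValue (n + 2) (componentOfMap C) (x :: y :: w) +
      componentValue (n + 2) (componentOfMap C) (y :: x :: w) =
        symbolValue n C w (B x y) := by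
  by_cases hw : w.length = n
  swap
  · rw [componentValue_eq_zero _ _ _ (by simpa using hw),
      componentValue_eq_zero _ _ _ (by simpa using hw), symbolValue_eq_zero n C w hw]
    simp
  cases n with
  | zero =>
    obtain rfl := List.eq_nil_of_length_eq_zero hw
    have h := (symbol_spec C).der Fin.elim0 x y
    have hs : ∀ z : E, (Fin.snoc (Fin.elim0 : Fin 0 → E) z : Fin 1 → E) = fun _ => z :=
      fun z => funext fun i => by rw [Fin.fin_one_eq_zero i]; rfl
    rw [hs, hs, hsymm x (C.1 _)] at h
    exact h.symm
  | succ m =>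
    -- The last letter `z` is not an argument of `C`; it is the vector `u` paired with the value of
    -- `C` in the axiom `symm`.
    obtain ⟨v, z, rfl⟩ : ∃ (v : Fin m → E) (z : E), w = List.ofFn v ++ [z] := by
      have hne : w ≠ [] := by rintro rfl; simp at hw
      have hl : w.dropLast.length = m := by simp [hw]
      subst hl
      exact ⟨w.dropLast.get, w.getLast hne, by
        rw [List.ofFn_get, List.dropLast_append_getLast]⟩
    have hc : ∀ x y : E, x :: y :: (List.ofFn v ++ [z]) =
        List.ofFn (Fin.cons x (Fin.cons y v : Fin (m + 1) → E) : Fin (m + 2) → E) ++ [z] :=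
      fun x y => by simp [List.ofFn_succ]
    have hz : List.ofFn v ++ [z] = List.ofFn (Fin.snoc v z : Fin (m + 1) → E) := by
      rw [List.ofFn_succ']
      simp [List.concat_eq_append]
    have h := (symbol_spec C).symm (Fin.cons x (Fin.cons y v : Fin (m + 1) → E)) z 0
    have h1 : (Fin.cons x (Fin.cons y v : Fin (m + 1) → E) : Fin (m + 2) → E) ∘
        Equiv.swap (Fin.castSucc 0) (Fin.succ 0) =
          (Fin.cons y (Fin.cons x v : Fin (m + 1) → E) : Fin (m + 2) → E) := by
      funext j
      refine Fin.cases (by simp) (fun j => Fin.cases (by simp) (fun j => ?_) j) j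
      rw [Function.comp_apply, Equiv.swap_apply_of_ne_of_ne]
      · simp
      · exact Fin.succ_ne_zero _
      · exact fun h => Fin.succ_ne_zero _ (Fin.succ_injective _ h)
    have h2 : elideTwo (0 : Fin (m + 1)).val
        (Fin.snoc (Fin.cons x (Fin.cons y v : Fin (m + 1) → E) : Fin (m + 2) → E) z :
          Fin (m + 3) → E) = (Fin.snoc v z : Fin (m + 1) → E) := by
      rw [← Fin.cons_snoc_eq_snoc_cons, ← Fin.cons_snoc_eq_snoc_cons]
      rfl
    rw [h1, h2] at h
    rw [hc, hc, componentValue_ofFn, componentValue_ofFn, hz, symbolValue_ofFn hfull]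
    simpa using h

theorem componentValue_append_cons_cons (hsymm : ∀ x y, B x y = B y x) (n : ℕ)
    (C : multibrackets R B n) (u : List E) (x y : E) (w : List E) :
    componentValue (n + 2) (componentOfMap C) (u ++ x :: y :: w) +
      componentValue (n + 2) (componentOfMap C) (u ++ y :: x :: w) =
        symbolValue n C (u ++ w) (B x y) := by
  induction u generalizing n with
  | nil => exact componentValue_cons_cons hfull hsymm n C x y w
  | cons l u ih =>
    cases n with
    | zero =>
      rw [componentValue_eq_zero _ _ _ (by simp; omega),
        componentValue_eq_zero _ _ _ (by simp; omega), symbolValue_eq_zero _ _ _ (by simp)]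
      simp
    | succ n => exact ih n (insertFirst l C)

/-- Each pair `(p,q)` contributes the symbol at `⟨a p, q⟩ = a⟨p,q⟩`, and these scalars sum to `a` by
the decomposition of `1`. -/
theorem anticommSum_componentValue (hsymm : ∀ x y, B x y = B y x)
    (hS : ∑ p ∈ S, B p.1 p.2 = 1) (n : ℕ) (C : multibrackets R B n) (u : List E) (a : A)
    (w : List E) :
    anticommSum S a (fun v => componentValue (n + 2) (componentOfMap C) (u ++ v)) w =
      symbolValue n C (u ++ w) a := by
  simp only [anticommSum]
  rw [Finset.sum_congr rfl fun p _ =>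
    componentValue_append_cons_cons hfull hsymm n C u (a • p.1) p.2 w, ← map_sum]
  simp only [map_smul, LinearMap.smul_apply, ← Finset.mul_sum, hS, smul_eq_mul, mul_one]

theorem isHeadCochain_componentValue (hsymm : ∀ x y, B x y = B y x)
    (hS : ∑ p ∈ S, B p.1 p.2 = 1) (r : ℕ) (c : Component R B r) :
    IsHeadCochain R B S (componentValue r c) := by
  have hadd : ∀ x y w, componentValue r c ((x + y) :: w) =
      componentValue r c (x :: w) + componentValue r c (y :: w) := by
    intro x y w
    cases r with
    | zero => exact (add_zero _).symm
    | succ r => simp only [componentValue, insertComponent_add, componentValue_add]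
  have hsmul : ∀ (a : R) x w, componentValue r c ((a • x) :: w) =
      a • componentValue r c (x :: w) := by
    intro a x w
    cases r with
    | zero => exact (smul_zero _).symm
    | succ r => simp only [componentValue, insertComponent_smul, componentValue_smul]
  match r, c with
  | 0, c =>
    refine ⟨hadd, hsmul, ?_, ?_, ?_, ?_⟩ <;> intros <;> simp [componentValue, anticommSum]
  | 1, c =>
    refine ⟨hadd, hsmul, fun a x => (B c).map_smul a x, ?_, ?_, ?_⟩ <;> intros <;>
      simp [componentValue, anticommSum]
  | n + 2, C =>
    have key := anticommSum_componentValue hfull hsymm hS n C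
    refine ⟨hadd, hsmul, fun a x => ?_, fun x y w => ?_, fun a x w => ?_, fun a b => ?_⟩
    · rw [componentValue_eq_zero _ _ _ (by simp), componentValue_eq_zero _ _ _ (by simp), mul_zero]
    · exact (componentValue_cons_cons hfull hsymm n C x y w).trans (key [] _ w).symm
    -- Both sides are the symbol at the word `x :: w`, read off after the empty prefix and after the
    -- prefix `[x]`.
    · exact (key [] a (x :: w)).trans (key [x] a w).symm
    · have h : ∀ a, anticommSum S a (componentValue (n + 2) C) [] =
        symbolValue n (C : multibrackets R B n) [] a := fun a => key [] a []
      simp only [h, Derivation.leibniz, smul_eq_mul]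

end Full

variable (B S) in
/-- The standing assumptions on the bilinear form, with a decomposition of `1`. -/
structure IsCourantForm : Prop where
  symm : ∀ x y, B x y = B y x
  bijective : Function.Bijective (B : E → Module.Dual A E)
  full : Function.Surjective (TensorProduct.lift B)
  sum_eq_one : ∑ p ∈ S, B p.1 p.2 = 1

variable (hBS : IsCourantForm B S)

theorem IsCourantForm.componentValue_mem (hBS : IsCourantForm B S) (r : ℕ) (c : Component R B r) :
    componentValue r c ∈ cochains R B S := by
  refine subset_cochains (R := R) {f | ∃ r, ∃ c : Component R B r, f = componentValue r c}
    ?_ ?_ ⟨r, c, rfl⟩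
  · rintro _ ⟨r, c, rfl⟩
    exact isHeadCochain_componentValue hBS.full hBS.symm hBS.sum_eq_one r c
  · rintro _ ⟨r, c, rfl⟩ x
    cases r with
    | zero => exact Submodule.zero_mem _
    | succ r => exact Submodule.subset_span ⟨r, insertComponent x r c, rfl⟩

variable (R) in
/-- The realization of the components by word functions. -/
def componentCochain (r : ℕ) : Component R B r →ₗ[R] cochains R B S where
  toFun c := ⟨componentValue r c, hBS.componentValue_mem r c⟩
  map_add' c d := Subtype.ext <| funext <| componentValue_add r c d
  map_smul' a c := Subtype.ext <| funext <| componentValue_smul a r c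

theorem componentCochain_apply (r : ℕ) (c : Component R B r) (w : List E) :
    (componentCochain R hBS r c).1 w = componentValue r c w := rfl

theorem isHomogeneousCochain_componentCochain (r : ℕ) (c : Component R B r) :
    IsHomogeneousCochain R B S r (componentCochain R hBS r c) :=
  fun w hw => componentValue_eq_zero r c w (by exact_mod_cast hw)

theorem contract_componentCochain_zero (x : E) (a : Component R B 0) :
    contract R B S x (componentCochain R hBS 0 a) = 0 := rfl

theorem contract_componentCochain_succ (x : E) (r : ℕ) (c : Component R B (r + 1)) :
    contract R B S x (componentCochain R hBS (r + 1) c) =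
      componentCochain R hBS r (insertComponent x r c) := rfl

theorem IsHomogeneousCochain.eq_zero_of_contract {n : ℤ} {f : cochains R B S}
    (hf : IsHomogeneousCochain R B S n f) (hn : n ≠ 0) (h : ∀ x, Courant.contract R B S x f = 0) :
    f = 0 := by
  refine cochains_ext fun w => ?_
  match w with
  | [] => exact hf.constTerm_eq_zero hn
  | x :: w => exact congrArg (fun g : cochains R B S => g.1 w) (h x)

theorem componentCochain_injective (r : ℕ) :
    Function.Injective (componentCochain R hBS r) := by
  rw [injective_iff_map_eq_zero]
  induction r with
  | zero => exact fun a h => congrArg (fun g : cochains R B S => g.1 []) h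
  | succ r ih =>
    refine fun c h => insertComponent_injective r c hBS.bijective.1 fun x => ih _ ?_
    rw [← contract_componentCochain_succ, h, map_zero]

variable (R B S) in
/-- The symbol of the degree two part. -/
def symbolMap : cochains R B S →ₗ[R] Derivation R A A where
  toFun f := Derivation.mk' ((constTerm R B S).comp ((scalarContract R B S).flip f))
    (constTerm_scalarContract_mul · · f)
  map_add' f g := Derivation.ext fun a => by
    change constTerm R B S (scalarContract R B S a (f + g)) =
      constTerm R B S (scalarContract R B S a f) + constTerm R B S (scalarContract R B S a g)
    simp only [map_add]
  map_smul' r f := Derivation.ext fun a => by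
    change constTerm R B S (scalarContract R B S a (r • f)) =
      r • constTerm R B S (scalarContract R B S a f)
    simp only [map_smul]

theorem symbolMap_apply (f : cochains R B S) (a : A) :
    symbolMap R B S f a = constTerm R B S (scalarContract R B S a f) := rfl

variable (R B S) in
/-- Iterated insertion of vectors. -/
def iterContract : ∀ n : ℕ,
    cochains R B S →ₗ[R] MultilinearMap R (fun _ : Fin n => E) (cochains R B S)
  | 0 =>
    { toFun := fun f => MultilinearMap.constOfIsEmpty R _ f
      map_add' := fun _ _ => rfl
      map_smul' := fun _ _ => rfl }
  | n + 1 =>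
    { toFun := fun f => LinearMap.uncurryLeft ((iterContract n).comp ((contract R B S).flip f))
      map_add' := fun f g => MultilinearMap.ext fun y => by simp
      map_smul' := fun r f => MultilinearMap.ext fun y => by simp }

theorem iterContract_succ (n : ℕ) (f : cochains R B S) (y : Fin (n + 1) → E) :
    iterContract R B S (n + 1) f y =
      iterContract R B S n (contract R B S (y 0) f) (Fin.tail y) := rfl

theorem iterContract_snoc (n : ℕ) (f : cochains R B S) (y : Fin n → E) (z : E) :
    iterContract R B S (n + 1) f (Fin.snoc y z : Fin (n + 1) → E) =
      contract R B S z (iterContract R B S n f y) := by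
  induction n generalizing f with
  | zero => rfl
  | succ n ih =>
    have h : (Fin.snoc y z : Fin (n + 2) → E) =
        Fin.cons (y 0) (Fin.snoc (Fin.tail y) z : Fin (n + 1) → E) := by
      rw [Fin.cons_snoc_eq_snoc_cons, Fin.cons_self_tail]
    rw [h, iterContract_succ, Fin.cons_zero, Fin.tail_cons, ih]
    rfl

theorem iterContract_scalarContract (n : ℕ) (a : A) (f : cochains R B S) (y : Fin n → E) :
    iterContract R B S n (scalarContract R B S a f) y =
      scalarContract R B S a (iterContract R B S n f y) := by
  induction n generalizing f with
  | zero => rfl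
  | succ n ih => rw [iterContract_succ, iterContract_succ, ← scalarContract_contract, ih]

theorem iterContract_swap (n : ℕ) (f : cochains R B S) (y : Fin (n + 2) → E) (i : Fin (n + 1)) :
    iterContract R B S (n + 2) f y +
        iterContract R B S (n + 2) f (y ∘ Equiv.swap i.castSucc i.succ) =
      scalarContract R B S (B (y i.castSucc) (y i.succ))
        (iterContract R B S n f (elideTwo i.val y)) := by
  induction n generalizing f with
  | zero =>
    obtain rfl := Fin.fin_one_eq_zero i
    exact contract_anticomm (y 0) (y 1) f
  | succ n ih =>
    refine Fin.cases ?_ (fun j => ?_) i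
    · rw [← iterContract_scalarContract]
      simp only [Fin.castSucc_zero, Fin.succ_zero_eq_one]
      rw [← contract_anticomm, map_add]
      have h : Fin.tail (Fin.tail (y ∘ Equiv.swap 0 1)) = Fin.tail (Fin.tail y) := by
        funext j
        change y (Equiv.swap 0 1 j.succ.succ) = y j.succ.succ
        rw [Equiv.swap_apply_of_ne_of_ne (a := 0) (b := 1) (Fin.succ_ne_zero _)
          fun h => Fin.succ_ne_zero _ (Fin.succ_injective _ h)]
      simp only [iterContract_succ (n + 2), iterContract_succ (n + 1), h]
      rfl
    · rw [iterContract_succ (n + 2) f y, iterContract_succ (n + 2) f (y ∘ _)]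
      have h1 : Fin.tail (y ∘ Equiv.swap j.succ.castSucc j.succ.succ) =
          Fin.tail y ∘ Equiv.swap j.castSucc j.succ := by
        funext k
        change y (Equiv.swap j.succ.castSucc j.succ.succ k.succ) =
          y (Equiv.swap j.castSucc j.succ k).succ
        congr 1
        simp only [Equiv.swap_apply_def, Fin.castSucc_succ, Fin.succ_inj]
        split_ifs <;> rfl
      have h2 : (y ∘ Equiv.swap j.succ.castSucc j.succ.succ) 0 = y 0 := by
        rw [Function.comp_apply, Equiv.swap_apply_of_ne_of_ne]
        · exact (Fin.succ_ne_zero j.castSucc).symm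
        · exact (Fin.succ_ne_zero _).symm
      have h3 : elideTwo j.succ.val y = Fin.cons (y 0) (elideTwo j.val (Fin.tail y)) := by
        rw [Fin.val_succ, ← elideTwo_succ_cons, Fin.cons_self_tail]
      rw [h1, h2, h3, iterContract_succ]
      exact ih _ (Fin.tail y) j

/-- The converse construction: `♯` turns the last slot into a value in `E`. Then `der` is
anticommutation of the last two letters, and `symm` that of an earlier adjacent pair. -/
theorem isSymbol_iterContract (n : ℕ) (f : cochains R B S) :
    IsSymbol B ((sharp R S hBS.bijective).compMultilinearMap (iterContract R B S (n + 1) f))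
      ((symbolMap R B S).compMultilinearMap (iterContract R B S n f)) := by
  constructor
  · intro x u w
    simp only [LinearMap.compMultilinearMap_apply, iterContract_snoc, symbolMap_apply,
      apply_sharp, apply_sharp_right hBS.bijective hBS.symm]
    rw [← contract_anticomm, map_add]
  · intro x u i
    have h := congrArg (constTerm R B S)
      -- With `u` appended as last letter, the positions exchanged at `i.castSucc` both lie in `x`,
      -- so `u` stays fixed.
      (iterContract_swap n f (Fin.snoc x u : Fin (n + 2) → E) i.castSucc)
    have h1 : (Fin.snoc x u : Fin (n + 2) → E) ∘
        Equiv.swap i.castSucc.castSucc i.castSucc.succ =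
          (Fin.snoc (x ∘ Equiv.swap i.castSucc i.succ) u : Fin (n + 2) → E) := by
      rw [Fin.succ_castSucc]
      funext k
      refine Fin.lastCases ?_ (fun k => ?_) k
      · rw [Function.comp_apply, Equiv.swap_apply_of_ne_of_ne]
        · simp
        · exact (Fin.castSucc_lt_last _).ne'
        · exact (Fin.castSucc_lt_last _).ne'
      · have : Equiv.swap i.castSucc.castSucc i.succ.castSucc k.castSucc =
            (Equiv.swap i.castSucc i.succ k).castSucc := by
          simp only [Equiv.swap_apply_def, Fin.castSucc_inj]
          split_ifs <;> rfl
        rw [Function.comp_apply, this, Fin.snoc_castSucc, Fin.snoc_castSucc, Function.comp_apply]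
    rw [h1, iterContract_snoc, iterContract_snoc, Fin.succ_castSucc, Fin.snoc_castSucc,
      Fin.snoc_castSucc, map_add] at h
    simp only [LinearMap.compMultilinearMap_apply, symbolMap_apply, map_add, LinearMap.add_apply,
      apply_sharp]
    exact h

/-- The element of a component determined by a word function. -/
noncomputable def cochainComponent : ∀ r : ℕ, cochains R B S → Component R B r
  | 0, f => f.1 []
  | 1, f => sharp R S hBS.bijective f
  | n + 2, f => componentOfMap ⟨_, _, isSymbol_iterContract hBS n f⟩

theorem insertComponent_cochainComponent (x : E) : ∀ (r : ℕ) (f : cochains R B S),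
    insertComponent x r (cochainComponent hBS (r + 1) f) =
      cochainComponent hBS r (contract R B S x f)
  | 0, f => apply_sharp hBS.bijective f x
  | 1, _ => rfl
  | _ + 2, _ => Subtype.ext <| MultilinearMap.ext fun _ => rfl

theorem componentCochain_cochainComponent (r : ℕ) (f : cochains R B S)
    (hf : IsHomogeneousCochain R B S r f) :
    componentCochain R hBS r (cochainComponent hBS r f) = f := by
  refine cochains_ext fun w => ?_
  induction r generalizing f w with
  | zero =>
    cases w with
    | nil => rfl
    | cons x w => exact (hf _ (by simp; omega)).symm
  | succ r ih =>
    cases w with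
    | nil => exact (hf _ (by simp; omega)).symm
    | cons x w =>
      refine Eq.trans ?_ (ih (contract R B S x f) (by simpa using hf.contract x) w)
      rw [← insertComponent_cochainComponent]
      rfl

end Realization


/-! ### Transport of the operations to `𝒞^•(E)`. -/

section Transfer

variable {R : Type v} {A E : Type u} [CommRing R] [CommRing A] [Algebra R A]
  [AddCommGroup E] [Module R E] [Module A E] [IsScalarTower R A E]
  {B : LinearMap.BilinForm A E} {S : Finset (E × E)} (hBS : IsCourantForm B S)

/-- An element of `A`, as an element of the component of degree `0`. -/
def componentOfScalar (a : A) : Component R B 0 := a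

/-- An element of `E`, as an element of the component of degree `1`. -/
def componentOfVector (x : E) : Component R B 1 := x

variable (R) in
/-- The word function of a scalar. -/
abbrev scalarCochain (a : A) : cochains R B S :=
  componentCochain R hBS 0 (componentOfScalar a)

variable (R) in
/-- The word function of a vector. -/
abbrev vectorCochain (x : E) : cochains R B S :=
  componentCochain R hBS 1 (componentOfVector x)

theorem constTerm_scalarCochain (a : A) : constTerm R B S (scalarCochain R hBS a) = a := rfl

theorem contract_vectorCochain (x y : E) :
    contract R B S y (vectorCochain R hBS x) = scalarCochain R hBS (B x y) := rfl

theorem scalarContract_scalarCochain (a b : A) :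
    scalarContract R B S a (scalarCochain R hBS b) = 0 := by
  simp [scalarContract_eq, contract_componentCochain_zero]

theorem scalarContract_vectorCochain (a : A) (x : E) :
    scalarContract R B S a (vectorCochain R hBS x) = 0 := by
  simp [scalarContract_eq, contract_vectorCochain, contract_componentCochain_zero]

theorem sharp_scalarCochain (a : A) :
    sharp R S hBS.bijective (scalarCochain R hBS a) = 0 :=
  (isHomogeneousCochain_componentCochain hBS 0 _).sharp_eq_zero hBS.bijective (by simp)

theorem sharp_vectorCochain (x : E) :
    sharp R S hBS.bijective (vectorCochain R hBS x) = x :=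
  hBS.bijective.1 <| LinearMap.ext fun y => by
    rw [apply_sharp, contract_vectorCochain, constTerm_scalarCochain]

theorem scalarContract_componentCochain_two (a : A) (D : multibrackets R B 0) :
    scalarContract R B S a (componentCochain R hBS 2 (componentOfMap D)) =
      scalarCochain R hBS (symbol D Fin.elim0 a) := by
  refine cochains_ext fun w => ?_
  rw [scalarContract_apply]
  refine (anticommSum_componentValue hBS.full hBS.symm hBS.sum_eq_one 0 D [] a w).trans ?_
  cases w <;> rfl

theorem cochainWedge_scalarCochain_apply (a : A) (f : cochains R B S) (w : List E) :
    (cochainWedge R B S (scalarCochain R hBS a) f).1 w = a * f.1 w := by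
  induction w generalizing f with
  | nil => rfl
  | cons x w ih =>
    rw [← contract_apply, contract_cochainWedge, contract_componentCochain_zero, map_zero,
      LinearMap.zero_apply, zero_add, ih]
    rfl

theorem cochainWedge_one (f : cochains R B S) :
    cochainWedge R B S (scalarCochain R hBS 1) f = f :=
  cochains_ext fun w => by rw [cochainWedge_scalarCochain_apply, one_mul]

theorem cochainWedge_scalar_scalar (a b : A) :
    cochainWedge R B S (scalarCochain R hBS a) (scalarCochain R hBS b) =
      scalarCochain R hBS (a * b) :=
  cochains_ext fun w => by
    rw [cochainWedge_scalarCochain_apply]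
    cases w with
    | nil => rfl
    | cons x w => exact mul_zero a

theorem cochainWedge_scalar_vector (a : A) (x : E) :
    cochainWedge R B S (scalarCochain R hBS a) (vectorCochain R hBS x) =
      vectorCochain R hBS (a • x) :=
  cochains_ext fun w => by
    rw [cochainWedge_scalarCochain_apply]
    match w with
    | [] => exact mul_zero a
    | [y] => exact (congrArg (fun φ : Module.Dual A E => φ y) (B.map_smul a x)).symm
    | _ :: _ :: _ => exact mul_zero a

theorem cochainWedge_vector_scalar (a : A) (x : E) :
    cochainWedge R B S (vectorCochain R hBS x) (scalarCochain R hBS a) =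
      vectorCochain R hBS (a • x) := by
  rw [cochainWedge_comm (isHomogeneousCochain_componentCochain hBS 1 _)
    (isHomogeneousCochain_componentCochain hBS 0 _), cochainWedge_scalar_vector,
    gradedSign_even (by simp), one_smul]

theorem cochainBracket_scalarCochain (a : A) (f : cochains R B S) :
    cochainBracket R S hBS.bijective hBS.symm f (scalarCochain R hBS a) =
      scalarContract R B S a f := by
  refine cochains_ext fun w => ?_
  induction w generalizing f with
  | nil =>
    rw [← constTerm_apply, ← constTerm_apply, constTerm_cochainBracket, constTerm_scalarCochain, scalarContract_scalarCochain,
      sharp_scalarCochain]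
    simp
  | cons x w ih =>
    rw [← contract_apply, contract_cochainBracket, contract_componentCochain_zero, map_zero,
      add_zero, (isHomogeneousCochain_componentCochain hBS 0 _).involute_eq,
      gradedSign_even (by simp), one_smul, ih, scalarContract_contract]
    rfl

/-- Inserting `y` into `[f,x]` gives, by induction, `-ι_x ι_y f + Δ_⟨x,y⟩ f`, which is `ι_y ι_x f`
by the anticommutation relation. Thus the derivation rule for insertions is the recursion required
of both operations. -/
theorem cochainBracket_vectorCochain (x : E) (f : cochains R B S) :
    cochainBracket R S hBS.bijective hBS.symm f (vectorCochain R hBS x) =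
      contract R B S x f := by
  refine cochains_ext fun w => ?_
  induction w generalizing f with
  | nil =>
    rw [← constTerm_apply, ← constTerm_apply, constTerm_cochainBracket, scalarContract_vectorCochain, sharp_vectorCochain, apply_sharp,
      (isHomogeneousCochain_componentCochain hBS 1 _).constTerm_eq_zero (by simp)]
    simp
  | cons y w ih =>
    rw [← contract_apply, contract_cochainBracket, contract_vectorCochain,
      cochainBracket_scalarCochain, (isHomogeneousCochain_componentCochain hBS 1 _).involute_eq,
      gradedSign_odd (by simp), map_smul, ← contract_anticomm]
    have h := ih (contract R B S y f)
    change (-1 : R) • (cochainBracket R S hBS.bijective hBS.symm (contract R B S y f)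
      (vectorCochain R hBS x)).1 w + ((contract R B S y (contract R B S x f)).1 w +
        (contract R B S x (contract R B S y f)).1 w) = (contract R B S y (contract R B S x f)).1 w
    rw [h, neg_one_smul, contract_apply]
    ring

variable (R) in
/-- The realization of `𝒞^•(E)` by word functions. -/
noncomputable def toCochain : CourantModule R B →ₗ[R] cochains R B S :=
  DirectSum.toModule R ℕ (cochains R B S) (componentCochain R hBS)

theorem toCochain_incl (r : ℕ) (c : Component R B r) :
    toCochain R hBS (incl R B r c) = componentCochain R hBS r c :=
  DirectSum.toModule_lof R r c

theorem toCochain_apply (c : CourantModule R B) (w : List E) :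
    (toCochain R hBS c).1 w = componentValue w.length (c w.length) w := by
  have hz : ∀ r, componentValue r (0 : Component R B r) w = 0 := fun r =>
    congrArg (fun f : cochains R B S => f.1 w) (map_zero (componentCochain R hBS r))
  induction c using DirectSum.induction_on with
  | zero => simp [hz]
  | of r c =>
    change (toCochain R hBS (incl R B r c)).1 w = _
    rw [toCochain_incl, componentCochain_apply]
    by_cases h : w.length = r
    · subst h
      rw [DirectSum.of_eq_same]
    · rw [DirectSum.of_eq_of_ne _ _ _ h, hz, componentValue_eq_zero r c w h]
  | add c d hc hd =>
    rw [map_add, DirectSum.add_apply, componentValue_add, ← hc, ← hd]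
    rfl

theorem toCochain_injective : Function.Injective (toCochain R hBS) := by
  rw [injective_iff_map_eq_zero]
  intro c hc
  refine DFinsupp.ext fun r => componentCochain_injective hBS r ?_
  rw [DFinsupp.zero_apply, map_zero]
  refine cochains_ext fun w => ?_
  by_cases h : w.length = r
  · subst h
    have := toCochain_apply hBS c w
    rw [hc] at this
    exact this.symm
  · exact componentValue_eq_zero r _ w h

/-- Degrees can be tested on words because every homogeneous cochain of degree `r ≥ 0` comes from
`𝒞^r`, and `toCochain` is injective. -/
theorem mem_homogeneous_iff (n : ℤ) (c : CourantModule R B) :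
    c ∈ homogeneous R B n ↔ IsHomogeneousCochain R B S n (toCochain R hBS c) := by
  cases n with
  | ofNat r =>
    constructor
    · rintro ⟨d, rfl⟩
      rw [toCochain_incl]
      exact isHomogeneousCochain_componentCochain hBS r d
    · intro h
      refine ⟨cochainComponent hBS r (toCochain R hBS c), toCochain_injective hBS ?_⟩
      rw [toCochain_incl]
      exact componentCochain_cochainComponent hBS r _ h
  | negSucc r =>
    constructor
    · rintro (rfl : c = 0)
      rw [map_zero]
      exact fun _ _ => rfl
    · intro h
      refine toCochain_injective hBS ?_
      rw [h.eq_zero (Int.negSucc_lt_zero r), map_zero]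

theorem incl_mem_homogeneous (r : ℕ) (c : Component R B r) :
    incl R B r c ∈ homogeneous R B (r : ℤ) := ⟨c, rfl⟩

include hBS in
theorem isInternal_homogeneous : DirectSum.IsInternal (homogeneous R B) := by
  constructor
  · rw [injective_iff_map_eq_zero]
    -- A word detects only the summand whose degree is its length.
    have key : ∀ (x : ⨁ n, homogeneous R B n) (w : List E),
        (toCochain R hBS (DirectSum.coeAddMonoidHom (homogeneous R B) x)).1 w =
          (toCochain R hBS (x (w.length : ℤ))).1 w := by
      intro x w
      induction x using DirectSum.induction_on with
      | zero => simp
      | of n c =>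
        rw [DirectSum.coeAddMonoidHom_of]
        by_cases h : (w.length : ℤ) = n
        · subst h
          rw [DirectSum.of_eq_same]
        · rw [DirectSum.of_eq_of_ne _ _ _ h, (mem_homogeneous_iff hBS n c.1).1 c.2 w h]
          simp
      | add x y hx hy =>
        rw [map_add, map_add, DirectSum.add_apply, Submodule.coe_add, Submodule.coe_add, map_add,
          Submodule.coe_add, Pi.add_apply, Pi.add_apply, hx, hy]
    intro x hx
    refine DFinsupp.ext fun n => Subtype.ext (toCochain_injective hBS ?_)
    refine cochains_ext fun w => ?_
    rw [DFinsupp.zero_apply, Submodule.coe_zero, map_zero]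
    by_cases h : (w.length : ℤ) = n
    · subst h
      rw [← key, hx, map_zero]
    · exact (mem_homogeneous_iff hBS n _).1 (x n).2 w h
  · intro c
    induction c using DirectSum.induction_on with
    | zero => exact ⟨0, map_zero _⟩
    | of r c =>
      refine ⟨DirectSum.of (fun n => homogeneous R B n) (r : ℤ)
        ⟨incl R B r c, incl_mem_homogeneous r c⟩, ?_⟩
      rw [DirectSum.coeAddMonoidHom_of]
      rfl
    | add c d hc hd =>
      obtain ⟨x, rfl⟩ := hc
      obtain ⟨y, rfl⟩ := hd
      exact ⟨x + y, map_add _ _ _⟩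

theorem exists_toCochain_eq {n : ℤ} {f : cochains R B S} (hf : IsHomogeneousCochain R B S n f) :
    ∃ c, toCochain R hBS c = f := by
  cases n with
  | ofNat r =>
    refine ⟨incl R B r (cochainComponent hBS r f), ?_⟩
    rw [toCochain_incl]
    exact componentCochain_cochainComponent hBS r f hf
  | negSucc r => exact ⟨0, by rw [hf.eq_zero (Int.negSucc_lt_zero r), map_zero]⟩

/-- A bilinear operation on word functions that respects the grading comes from one on
`𝒞^•(E)`. -/
theorem exists_lift_operation (op : cochains R B S →ₗ[R] cochains R B S →ₗ[R] cochains R B S)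
    (k : ℤ) (hop : ∀ (m n : ℤ) (f g), IsHomogeneousCochain R B S m f →
      IsHomogeneousCochain R B S n g → IsHomogeneousCochain R B S (m + n + k) (op f g)) :
    ∃ op' : CourantModule R B →ₗ[R] CourantModule R B →ₗ[R] CourantModule R B,
      ∀ c d, toCochain R hBS (op' c d) = op (toCochain R hBS c) (toCochain R hBS d) := by
  have h : ∀ c d, ∃ e, toCochain R hBS e = op (toCochain R hBS c) (toCochain R hBS d) := by
    intro c d
    induction c using DirectSum.induction_on with
    | zero => exact ⟨0, by simp⟩
    | add c c' hc hc' =>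
      obtain ⟨e, he⟩ := hc
      obtain ⟨e', he'⟩ := hc'
      exact ⟨e + e', by rw [map_add, he, he', map_add, map_add, LinearMap.add_apply]⟩
    | of r c =>
      induction d using DirectSum.induction_on with
      | zero => exact ⟨0, by simp⟩
      | add d d' hd hd' =>
        obtain ⟨e, he⟩ := hd
        obtain ⟨e', he'⟩ := hd'
        exact ⟨e + e', by rw [map_add, he, he', map_add, map_add]⟩
      | of s d =>
        exact exists_toCochain_eq hBS (hop r s _ _
          ((mem_homogeneous_iff hBS _ _).1 (incl_mem_homogeneous r c))
          ((mem_homogeneous_iff hBS _ _).1 (incl_mem_homogeneous s d)))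
  -- Preimages are unique, so the chosen ones are automatically bilinear.
  choose e he using h
  refine ⟨LinearMap.mk₂ R e ?_ ?_ ?_ ?_, he⟩ <;> intros <;> apply toCochain_injective hBS <;>
    simp only [he, map_add, map_smul, LinearMap.add_apply, LinearMap.smul_apply]

theorem toCochain_ofScalar (a : A) :
    toCochain R hBS (ofScalar R B a) = scalarCochain R hBS a := toCochain_incl hBS 0 _

theorem toCochain_ofVector (x : E) :
    toCochain R hBS (ofVector R B x) = vectorCochain R hBS x := toCochain_incl hBS 1 _

theorem toCochain_ofMap {n : ℕ} (C : multibrackets R B n) :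
    toCochain R hBS (ofMap C) = componentCochain R hBS (n + 2) (componentOfMap C) :=
  toCochain_incl hBS (n + 2) _

theorem insertion_eq_incl (x : E) : ∀ {n : ℕ} (C : multibrackets R B n),
    insertion x C = incl R B (n + 1) (insertComponent x (n + 1) (componentOfMap C))
  | 0, _ => rfl
  | _ + 1, _ => rfl

theorem toCochain_insertion (x : E) {n : ℕ} (C : multibrackets R B n) :
    toCochain R hBS (insertion x C) =
      contract R B S x (componentCochain R hBS (n + 2) (componentOfMap C)) := by
  rw [insertion_eq_incl, toCochain_incl, contract_componentCochain_succ]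

variable {br w : CourantModule R B →ₗ[R] CourantModule R B →ₗ[R] CourantModule R B}

theorem isBracket_of_toCochain
    (hbr : ∀ c d, toCochain R hBS (br c d) =
      cochainBracket R S hBS.bijective hBS.symm (toCochain R hBS c) (toCochain R hBS d)) :
    IsBracket R B br := by
  have hskew : ∀ (r s : ℕ) (c : Component R B r) (d : Component R B s),
      br (incl R B r c) (incl R B s d) =
        -((-1 : ℤ) ^ (r * s) • br (incl R B s d) (incl R B r c)) := by
    intro r s c d
    apply toCochain_injective hBS
    rw [map_neg, map_zsmul, hbr, hbr, cochainBracket_skew hBS.bijective hBS.symm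
      ((mem_homogeneous_iff hBS _ _).1 (incl_mem_homogeneous r c))
      ((mem_homogeneous_iff hBS _ _).1 (incl_mem_homogeneous s d)), ← Nat.cast_mul,
      gradedSign_natCast, ← Int.cast_smul_eq_zsmul R]
    simp
  have hvec : ∀ c x, toCochain R hBS (br c (ofVector R B x)) =
      contract R B S x (toCochain R hBS c) := fun c x => by
    rw [hbr, toCochain_ofVector, cochainBracket_vectorCochain]
  have hscal : ∀ c a, toCochain R hBS (br c (ofScalar R B a)) =
      scalarContract R B S a (toCochain R hBS c) := fun c a => by
    rw [hbr, toCochain_ofScalar, cochainBracket_scalarCochain]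
  refine ⟨fun m n c hc d hd => ?_, hskew, fun a b => ?_, fun a x => ?_, fun a x => ?_,
    fun x y => ?_, fun D a => ?_, fun D a => ?_, fun n C x => ?_, fun n C x => ?_,
    fun r s c d x => ?_⟩
  · rw [mem_homogeneous_iff hBS] at hc hd ⊢
    rw [hbr]
    exact isHomogeneousCochain_cochainBracket hBS.bijective hBS.symm hc hd
  · apply toCochain_injective hBS
    rw [hscal, toCochain_ofScalar, scalarContract_scalarCochain, map_zero]
  · apply toCochain_injective hBS
    rw [hvec, toCochain_ofScalar, contract_componentCochain_zero, map_zero]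
  · apply toCochain_injective hBS
    rw [hscal, toCochain_ofVector, scalarContract_vectorCochain, map_zero]
  · apply toCochain_injective hBS
    rw [hvec, toCochain_ofVector, contract_vectorCochain, toCochain_ofScalar]
  · apply toCochain_injective hBS
    rw [hscal, toCochain_ofMap, scalarContract_componentCochain_two, toCochain_ofScalar]
  · apply toCochain_injective hBS
    have h := hskew 0 2 (componentOfScalar a) (componentOfMap D)
    rw [zero_mul, pow_zero, one_smul] at h
    refine (congrArg _ h).trans ?_
    rw [map_neg, map_neg, toCochain_ofScalar, ← scalarContract_componentCochain_two,
      ← toCochain_ofMap, ← hscal]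
    rfl
  · apply toCochain_injective hBS
    rw [hvec, toCochain_ofMap, toCochain_insertion]
  · apply toCochain_injective hBS
    have h := hskew 1 (n + 2) (componentOfVector x) (componentOfMap C)
    rw [one_mul] at h
    change br (ofVector R B x) (ofMap C) = -((-1 : ℤ) ^ (n + 2) • br (ofMap C) (ofVector R B x))
      at h
    rw [h, smul_neg, smul_smul, pow_succ, mul_assoc, neg_one_mul, mul_neg, ← mul_pow]
    simp [hvec, toCochain_ofMap, toCochain_insertion]
  · apply toCochain_injective hBS
    rw [hvec, map_add, map_zsmul, hbr (incl R B r c) (incl R B s d), hbr (br _ _), hvec,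
      hbr _ (br _ _), hvec, contract_cochainBracket,
      ((mem_homogeneous_iff hBS _ _).1 (incl_mem_homogeneous s d)).involute_eq, map_smul,
      gradedSign_natCast, ← Int.cast_smul_eq_zsmul R]
    simp

theorem isWedge_of_toCochain
    (hbr : ∀ c d, toCochain R hBS (br c d) =
      cochainBracket R S hBS.bijective hBS.symm (toCochain R hBS c) (toCochain R hBS d))
    (hw : ∀ c d, toCochain R hBS (w c d) =
      cochainWedge R B S (toCochain R hBS c) (toCochain R hBS d)) :
    IsWedge R B br w := by
  have hvec : ∀ c x, toCochain R hBS (br c (ofVector R B x)) =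
      contract R B S x (toCochain R hBS c) := fun c x => by
    rw [hbr, toCochain_ofVector, cochainBracket_vectorCochain]
  refine ⟨fun m n c hc d hd => ?_, fun a b => ?_, fun a x => ?_, fun a x => ?_,
    fun r s c d x => ?_⟩
  · rw [mem_homogeneous_iff hBS] at hc hd ⊢
    rw [hw]
    exact isHomogeneousCochain_cochainWedge hc hd
  · apply toCochain_injective hBS
    rw [hw, toCochain_ofScalar, toCochain_ofScalar, cochainWedge_scalar_scalar,
      toCochain_ofScalar]
  · apply toCochain_injective hBS
    rw [hw, toCochain_ofScalar, toCochain_ofVector, cochainWedge_scalar_vector,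
      toCochain_ofVector]
  · apply toCochain_injective hBS
    rw [hw, toCochain_ofScalar, toCochain_ofVector, cochainWedge_vector_scalar,
      toCochain_ofVector]
  · apply toCochain_injective hBS
    rw [hvec, map_add, map_zsmul, hw (incl R B r c) (incl R B s d), hw (br _ _), hvec,
      hw _ (br _ _), hvec, contract_cochainWedge,
      ((mem_homogeneous_iff hBS _ _).1 (incl_mem_homogeneous s d)).involute_eq, map_smul,
      gradedSign_natCast, ← Int.cast_smul_eq_zsmul R]
    simp

theorem isGradedPoissonAlgebra_of_toCochain
    (hbr : ∀ c d, toCochain R hBS (br c d) =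
      cochainBracket R S hBS.bijective hBS.symm (toCochain R hBS c) (toCochain R hBS d))
    (hw : ∀ c d, toCochain R hBS (w c d) =
      cochainWedge R B S (toCochain R hBS c) (toCochain R hBS d)) :
    IsGradedPoissonAlgebra R (-2) (homogeneous R B) br w := by
  have hsign : ∀ (n : ℤ) (c : CourantModule R B), n.negOnePow • c = gradedSign R n • c :=
    fun n c => by rw [Units.smul_def, gradedSign, Int.cast_smul_eq_zsmul]
  -- The shift by `-2` is even, so the signs of the shifted grading agree with those of the original
  -- one.
  have heven : ∀ m n : ℤ, gradedSign R ((m + -2) * n) = gradedSign R (m * n) := fun m n => by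
    rw [add_mul, gradedSign_add, gradedSign_even (n := -2 * n) (by simp), mul_one]
  have hhom := mem_homogeneous_iff (R := R) hBS
  refine ⟨isInternal_homogeneous hBS, (isWedge_of_toCochain hBS hbr hw).degree, fun c d e => ?_,
    fun m n c hc d hd => ?_, ⟨ofScalar R B 1, ⟨_, rfl⟩, fun c => ?_⟩,
    (isBracket_of_toCochain hBS hbr).degree, fun m n c hc d hd => ?_,
    fun m n p c hc d hd e he => ?_, fun m n p c hc d hd e he => ?_⟩
  · apply toCochain_injective hBS
    simp only [hw, cochainWedge_assoc]
  · apply toCochain_injective hBS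
    rw [hsign, map_smul, hw, hw, cochainWedge_comm ((hhom _ _).1 hc) ((hhom _ _).1 hd)]
  · have h : w (ofScalar R B 1) c = c := by
      apply toCochain_injective hBS
      rw [hw, toCochain_ofScalar, cochainWedge_one]
    refine ⟨h, ?_⟩
    suffices hcomm : w c (ofScalar R B 1) = w (ofScalar R B 1) c from hcomm.trans h
    clear h
    induction c using DirectSum.induction_on with
    | zero => simp
    | add c d hc hd => rw [map_add, map_add, LinearMap.add_apply, hc, hd]
    | of r c =>
      apply toCochain_injective hBS
      change toCochain R hBS (w (incl R B r c) _) = toCochain R hBS (w _ (incl R B r c))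
      rw [hw, hw, toCochain_ofScalar, cochainWedge_comm
        ((hhom _ _).1 (incl_mem_homogeneous r c)) (isHomogeneousCochain_componentCochain hBS 0 _),
        gradedSign_even (by simp), one_smul]
  · apply toCochain_injective hBS
    rw [hsign, heven, mul_comm, heven, mul_comm, map_neg, map_smul, hbr, hbr,
      cochainBracket_skew _ _ ((hhom _ _).1 hc) ((hhom _ _).1 hd)]
  · apply toCochain_injective hBS
    rw [hsign, heven, mul_comm, heven, mul_comm, map_add, map_smul]
    simp only [hbr]
    exact cochainBracket_jacobi _ _ ((hhom _ _).1 hc) ((hhom _ _).1 hd) ((hhom _ _).1 he)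
  · apply toCochain_injective hBS
    rw [hsign, heven, map_add, map_smul]
    simp only [hbr, hw]
    exact cochainBracket_wedge _ _ _ ((hhom _ _).1 hc) ((hhom _ _).1 hd)

/-! ### Uniqueness of the operations. -/

theorem IsBracket.incl_zero_vector (hbr : IsBracket R B br) (c : Component R B 0) (x : E) :
    br (incl R B 0 c) (ofVector R B x) = 0 := hbr.scalar_vector c x

theorem IsBracket.incl_succ_vector (hbr : IsBracket R B br) (x : E) :
    ∀ (r : ℕ) (c : Component R B (r + 1)),
      br (incl R B (r + 1) c) (ofVector R B x) = incl R B r (insertComponent x r c)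
  | 0, c => hbr.vector_vector c x
  | n + 1, C => (hbr.map_vector n C x).trans (insertion_eq_incl x (n := n) C)

/-- The axioms prescribe the bracket with a vector on the right outright, so the recursion of any
other bracket can be rewritten with insertions taken by `br`. -/
theorem IsBracket.vector_right_unique {br' : CourantModule R B →ₗ[R] CourantModule R B →ₗ[R]
    CourantModule R B} (hbr : IsBracket R B br) (hbr' : IsBracket R B br')
    (c : CourantModule R B) (x : E) : br' c (ofVector R B x) = br c (ofVector R B x) := by
  induction c using DirectSum.induction_on with
  | zero => simp
  | add c d hc hd => rw [map_add, map_add, LinearMap.add_apply, LinearMap.add_apply, hc, hd]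
  | of r c =>
    cases r with
    | zero => exact (hbr'.incl_zero_vector c x).trans (hbr.incl_zero_vector c x).symm
    | succ r => exact (hbr'.incl_succ_vector x r c).trans (hbr.incl_succ_vector x r c).symm

/-- Two operations for which brackets with vectors are graded derivations coincide if they coincide
whenever the result has degree at most `0`. -/
theorem eq_of_recursion
    (hbr : ∀ c d, toCochain R hBS (br c d) =
      cochainBracket R S hBS.bijective hBS.symm (toCochain R hBS c) (toCochain R hBS d))
    (k : ℤ) {op op' : CourantModule R B →ₗ[R] CourantModule R B →ₗ[R] CourantModule R B}
    (hdeg : ∀ (m n : ℤ), ∀ c ∈ homogeneous R B m, ∀ d ∈ homogeneous R B n,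
      op c d ∈ homogeneous R B (m + n + k))
    (hdeg' : ∀ (m n : ℤ), ∀ c ∈ homogeneous R B m, ∀ d ∈ homogeneous R B n,
      op' c d ∈ homogeneous R B (m + n + k))
    (hrec : ∀ (r s : ℕ) (c : Component R B r) (d : Component R B s) (x : E),
      br (op (incl R B r c) (incl R B s d)) (ofVector R B x) =
        (-1 : ℤ) ^ s • op (br (incl R B r c) (ofVector R B x)) (incl R B s d) +
          op (incl R B r c) (br (incl R B s d) (ofVector R B x)))
    (hrec' : ∀ (r s : ℕ) (c : Component R B r) (d : Component R B s) (x : E),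
      br (op' (incl R B r c) (incl R B s d)) (ofVector R B x) =
        (-1 : ℤ) ^ s • op' (br (incl R B r c) (ofVector R B x)) (incl R B s d) +
          op' (incl R B r c) (br (incl R B s d) (ofVector R B x)))
    (hlow : ∀ (r s : ℕ) (c : Component R B r) (d : Component R B s), (r : ℤ) + s + k ≤ 0 →
      op' (incl R B r c) (incl R B s d) = op (incl R B r c) (incl R B s d)) :
    op' = op := by
  have hbr' := isBracket_of_toCochain hBS hbr
  have hvec : ∀ c x, toCochain R hBS (br c (ofVector R B x)) =
      contract R B S x (toCochain R hBS c) := fun c x => by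
    rw [hbr, toCochain_ofVector, cochainBracket_vectorCochain]
  have key : ∀ (N r s : ℕ) (c : Component R B r) (d : Component R B s), r + s = N →
      op' (incl R B r c) (incl R B s d) = op (incl R B r c) (incl R B s d) := by
    intro N
    induction N with
    | zero =>
      intro r s c d h
      by_cases hk : (r : ℤ) + s + k ≤ 0
      · exact hlow r s c d hk
      obtain ⟨rfl, rfl⟩ : r = 0 ∧ s = 0 := by omega
      apply toCochain_injective hBS
      rw [← sub_eq_zero, ← map_sub]
      -- Here the result has positive degree `k`, but scalars have no insertions, so by the
      -- recursion all insertions of both results vanish.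
      refine IsHomogeneousCochain.eq_zero_of_contract (n := ((0 : ℕ) : ℤ) + (0 : ℕ) + k) ?_
        (by omega) fun x => ?_
      · rw [← mem_homogeneous_iff]
        exact Submodule.sub_mem _
          (hdeg' _ _ _ (incl_mem_homogeneous 0 c) _ (incl_mem_homogeneous 0 d))
          (hdeg _ _ _ (incl_mem_homogeneous 0 c) _ (incl_mem_homogeneous 0 d))
      · rw [← hvec, map_sub, LinearMap.sub_apply, hrec, hrec']
        simp [hbr'.incl_zero_vector]
    | succ N ih =>
      intro r s c d h
      by_cases hk : (r : ℤ) + s + k ≤ 0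
      · exact hlow r s c d hk
      apply toCochain_injective hBS
      rw [← sub_eq_zero, ← map_sub]
      -- In positive degree the difference is determined by its insertions, and the recursion
      -- reduces these to pairs of total degree `N`.
      refine IsHomogeneousCochain.eq_zero_of_contract (n := (r : ℤ) + s + k) ?_
        (by omega) fun x => ?_
      · rw [← mem_homogeneous_iff]
        exact Submodule.sub_mem _
          (hdeg' _ _ _ (incl_mem_homogeneous r c) _ (incl_mem_homogeneous s d))
          (hdeg _ _ _ (incl_mem_homogeneous r c) _ (incl_mem_homogeneous s d))
      · have h1 : op' (br (incl R B r c) (ofVector R B x)) (incl R B s d) =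
            op (br (incl R B r c) (ofVector R B x)) (incl R B s d) := by
          cases r with
          | zero => simp [hbr'.incl_zero_vector]
          | succ r =>
            rw [hbr'.incl_succ_vector]
            exact ih r s _ d (by omega)
        have h2 : op' (incl R B r c) (br (incl R B s d) (ofVector R B x)) =
            op (incl R B r c) (br (incl R B s d) (ofVector R B x)) := by
          cases s with
          | zero => simp [hbr'.incl_zero_vector]
          | succ s =>
            rw [hbr'.incl_succ_vector]
            exact ih r s c _ (by omega)
        rw [← hvec, map_sub, LinearMap.sub_apply, hrec, hrec', h1, h2, sub_self, map_zero]
  refine LinearMap.ext fun c => LinearMap.ext fun d => ?_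
  induction c using DirectSum.induction_on with
  | zero => simp
  | add c c' hc hc' => rw [map_add, map_add, LinearMap.add_apply, LinearMap.add_apply, hc, hc']
  | of r c =>
    induction d using DirectSum.induction_on with
    | zero => simp
    | add d d' hd hd' => rw [map_add, map_add, hd, hd']
    | of s d => exact key _ r s c d rfl

theorem IsBracket.unique
    (hbr : ∀ c d, toCochain R hBS (br c d) =
      cochainBracket R S hBS.bijective hBS.symm (toCochain R hBS c) (toCochain R hBS d))
    {br' : CourantModule R B →ₗ[R] CourantModule R B →ₗ[R] CourantModule R B}
    (hbr' : IsBracket R B br') : br' = br := by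
  have h := isBracket_of_toCochain hBS hbr
  have huniq := h.vector_right_unique hbr'
  refine eq_of_recursion hBS hbr (-2) h.degree hbr'.degree h.recursion
    (fun r s c d x => ?_) fun r s c d hrs => ?_
  · rw [← huniq, ← huniq, ← huniq]
    exact hbr'.recursion r s c d x
  -- The six pairs with `r + s ≤ 2` are exactly those with prescribed values.
  · match r, s, c, d, hrs with
    | 0, 0, c, d, _ => exact (hbr'.scalar_scalar c d).trans (h.scalar_scalar c d).symm
    | 0, 1, c, d, _ => exact (hbr'.scalar_vector c d).trans (h.scalar_vector c d).symm
    | 1, 0, c, d, _ => exact (hbr'.vector_scalar d c).trans (h.vector_scalar d c).symm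
    | 1, 1, c, d, _ => exact (hbr'.vector_vector c d).trans (h.vector_vector c d).symm
    | 2, 0, c, d, _ => exact (hbr'.map_scalar c d).trans (h.map_scalar c d).symm
    | 0, 2, c, d, _ => exact (hbr'.scalar_map d c).trans (h.scalar_map d c).symm
    | 0, s + 3, _, _, hrs => exact absurd hrs (by push_cast; omega)
    | 1, s + 2, _, _, hrs => exact absurd hrs (by push_cast; omega)
    | 2, s + 1, _, _, hrs => exact absurd hrs (by push_cast; omega)
    | r + 3, s, _, _, hrs => exact absurd hrs (by push_cast; omega)

theorem IsWedge.unique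
    (hbr : ∀ c d, toCochain R hBS (br c d) =
      cochainBracket R S hBS.bijective hBS.symm (toCochain R hBS c) (toCochain R hBS d))
    (hw : IsWedge R B br w)
    {w' : CourantModule R B →ₗ[R] CourantModule R B →ₗ[R] CourantModule R B}
    (hw' : IsWedge R B br w') : w' = w := by
  refine eq_of_recursion hBS hbr 0 (fun m n c hc d hd => ?_) (fun m n c hc d hd => ?_)
    hw.recursion hw'.recursion fun r s c d hrs => ?_
  · rw [add_zero]
    exact hw.degree m n c hc d hd
  · rw [add_zero]
    exact hw'.degree m n c hc d hd
  · obtain ⟨rfl, rfl⟩ : r = 0 ∧ s = 0 := by omega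
    exact (hw'.scalar_scalar c d).trans (hw.scalar_scalar c d).symm

end Transfer

/-- A tensor mapping to `1`, written as a finite sum of pure tensors, provides the set `S` from
which symbols are recovered. -/
theorem exists_isCourantForm {A E : Type u} [CommRing A] [AddCommGroup E] [Module A E]
    (B : LinearMap.BilinForm A E) (hsymm : ∀ x y, B x y = B y x)
    (hnondeg : Function.Bijective (B : E → Module.Dual A E))
    (hfull : Function.Surjective (TensorProduct.lift B)) : ∃ S, IsCourantForm B S := by
  obtain ⟨t, ht⟩ := hfull 1
  obtain ⟨S, rfl⟩ := TensorProduct.exists_finset t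
  refine ⟨S, hsymm, hnondeg, hfull, ?_⟩
  simpa using ht

end Courant

theorem mainTheorem1 {R : Type v} {A E : Type u} [CommRing R] [Algebra ℚ R]
    [CommRing A] [Algebra R A] [AddCommGroup E] [Module R E] [Module A E] [IsScalarTower R A E]
    [Module.Finite A E] [Module.Projective A E]
    (B : LinearMap.BilinForm A E) (hsymm : ∀ x y, B x y = B y x)
    (hnondeg : Function.Bijective (B : E → Module.Dual A E))
    (hfull : Function.Surjective (TensorProduct.lift B)) :
    ∃ br w : Courant.CourantModule R B →ₗ[R] Courant.CourantModule R B →ₗ[R] Courant.CourantModule R B,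
      (Courant.IsBracket R B br ∧ ∀ br', Courant.IsBracket R B br' → br' = br) ∧
      (Courant.IsWedge R B br w ∧ ∀ w', Courant.IsWedge R B br w' → w' = w) ∧
      Courant.IsGradedPoissonAlgebra R (-2) (Courant.homogeneous R B) br w := by
  obtain ⟨S, hBS⟩ := Courant.exists_isCourantForm B hsymm hnondeg hfull
  obtain ⟨br, hbr⟩ := Courant.exists_lift_operation hBS
    (Courant.cochainBracket R S hBS.bijective hBS.symm) (-2)
    fun _ _ _ _ => Courant.isHomogeneousCochain_cochainBracket hBS.bijective hBS.symm
  obtain ⟨w, hw⟩ := Courant.exists_lift_operation hBS (Courant.cochainWedge R B S) 0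
    fun m n _ _ hf hg => (add_zero (m + n)).symm ▸ Courant.isHomogeneousCochain_cochainWedge hf hg
  have hwedge := Courant.isWedge_of_toCochain hBS hbr hw
  exact ⟨br, w, ⟨Courant.isBracket_of_toCochain hBS hbr, fun _ h => h.unique hBS hbr⟩,
    ⟨hwedge, fun _ h => hwedge.unique hBS hbr h⟩,
    Courant.isGradedPoissonAlgebra_of_toCochain hBS hbr hw⟩
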